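/- **Setting.** Let $K$ be a compact Lie group with normalized Haar measure $d\kappa$, acting continuously, linearly and by isometries on $\mathbb{R}^{\mathcal D}$. Let $x_1,\dots,x_N\in\mathbb{R}^{\mathcal D}$ and $\varepsilon>0$. For $\kappa,\mu\in K$ put $$W_{ij}(\kappa,\mu)=\exp\!\left(-\|\kappa\cdot x_i-\mu\cdot x_j\|^2/\varepsilon\right),\qquad D_{ii}=\sum_{j=1}^N\int_K W_{ij}(\mathrm{Id},\mu)\,d\mu ,\qquad D=\operatorname{diag}(D_{11},\dots,D_{NN}).$$ Let $\mathcal H=L^2(\{1,\dots,N\}\times K;\mathbb{C})$ with $\langle g,f\rangle=\sum_{i}\int_K \overline{g(i,\kappa)}f(i,\kappa)\,d\kappa$, and let the $K$-invariant graph Laplacian $L=D-W:\mathcal H\to\mathcal H$ be $$Lf(i,\kappa)=D_{ii}\,f(i,\kappa)-\sum_{j=1}^N\int_K W_{ij}(\kappa,\mu)f(j,\mu)\,d\mu .$$ Let $(U_\ell)_{\ell\in\mathcal I}$ be a complete list of the (continuous, finite-dimensional) irreducible unitary matrix representations of $K$, one from each equivalence class, with $U_\ell(\kappa)$ of size $d_\ell\times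 d_\ell$. Let $\widehat W^{(\ell)}$ be the $Nd_\ell\times Nd_\ell$ matrix whose $(i,j)$-th block, of size $d_\ell\times d_\ell$, is $\int_K W_{ij}(\mathrm{Id},\kappa)U_\ell(\kappa)\,d\kappa$, and put $S_\ell=D\otimes I_{d_\ell}-\widehat W^{(\ell)}$. **Theorem.** The operator $L$ is self-adjoint and positive semidefinite, and every $S_\ell$ is Hermitian. A complex number is an eigenvalue of $L$ if and only if it is an eigenvalue of $S_\ell$ for some $\ell\in\mathcal I$. For each $\ell$ there is an orthonormal system $v^{(\ell,1)},\dots,v^{(\ell,Nd_\ell)}$ in $\mathbb{C}^{Nd_\ell}$ of eigenvectors of $S_\ell$ with real eigenvalues $\lambda_{\ell,1},\dots,\lambda_{\ell,Nd_\ell}$. For every choice of such systems, one for each $\ell\in\mathcal I$, all $\lambda_{\ell,s}$ are nonnegative, and the functions $$\Phi^{(\ell,s)}_m(i,\kappa)=\sum_{n=1}^{d_\ell}U_\ell(\kappa)_{mn}\,v^{(\ell,s)}_{(i-1)d_\ell+n}\qquad(\ell\in\mathcal I,\ 1\le s\le Nd_\ell,\ 1\le m\le d_\ell)$$ are nonzero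 elements of $\mathcal H$ with $L\Phi^{(\ell,s)}_m=\lambda_{\ell,s}\Phi^{(\ell,s)}_m$, are pairwise orthogonal for distinct triples $(\ell,s,m)$, and have dense linear span in $\mathcal H$. -/

import Mathlib

open MeasureTheory TopologicalSpace
open scoped Matrix Kronecker ContDiff Manifold ENNReal ComplexConjugate

noncomputable section

namespace InvariantGraphLaplacian

section Haar

variable (K : Type*) [Group K] [TopologicalSpace K] [IsTopologicalGroup K] [CompactSpace K]
  [MeasurableSpace K] [BorelSpace K]

/-- The normalized Haar measure of a compact group. -/
def haarProb : Measure K := Measure.haarMeasure (⊤ : PositiveCompacts K)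

instance : IsProbabilityMeasure (haarProb K) := ⟨by
  have h := Measure.haarMeasure_self (K₀ := (⊤ : PositiveCompacts K))
  simpa [haarProb] using h⟩

/-- The measure on `Γ = {1, …, N} × K`: counting measure times normalized Haar measure. -/
def gammaMeasure (N : ℕ) : Measure (Fin N × K) := Measure.count.prod (haarProb K)

instance (N : ℕ) : IsFiniteMeasure (gammaMeasure K N) := by
  unfold gammaMeasure; infer_instance

/-- The complex Hilbert space `L²({1, …, N} × K)`. -/
abbrev GammaL2 (N : ℕ) : Type _ := Lp ℂ 2 (gammaMeasure K N)

end Haar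

section Affinity

variable {K : Type*} [Group K] {V : Type*} [NormedAddCommGroup V] [MulAction K V] {N : ℕ}

/-- The affinity `W_{ij}(κ, μ) = exp(-‖κ·x_i - μ·x_j‖² / ε)`. -/
def affinity (ε : ℝ) (x : Fin N → V) (i j : Fin N) (κ μ : K) : ℝ :=
  Real.exp (-‖κ • x i - μ • x j‖ ^ 2 / ε)

theorem continuous_affinity [TopologicalSpace K] [ContinuousSMul K V] (ε : ℝ) (x : Fin N → V)
    (i j : Fin N) :
    Continuous fun p : K × K => affinity ε x i j p.1 p.2 := by
  unfold affinity
  fun_prop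

end Affinity

section Laplacian

variable {K : Type*} [Group K] [TopologicalSpace K] [IsTopologicalGroup K] [CompactSpace K]
  [MeasurableSpace K] [BorelSpace K]
  {V : Type*} [NormedAddCommGroup V] [MulAction K V] [ContinuousSMul K V]
  {N : ℕ}

/-- The degree `D_{ii} = ∑_j ∫_K W_{ij}(1, μ) dμ`. -/
def degree (K : Type*) [Group K] [TopologicalSpace K] [IsTopologicalGroup K] [CompactSpace K]
    [MeasurableSpace K] [BorelSpace K] [MulAction K V]
    (ε : ℝ) (x : Fin N → V) (i : Fin N) : ℝ :=
  ∑ j, ∫ μ, affinity ε x i j (1 : K) μ ∂(haarProb K)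

/-- `(W f)(i, κ) = ∑_j ∫_K W_{ij}(κ, μ) f(j, μ) dμ`. -/
def affinityFun (ε : ℝ) (x : Fin N → V) (f : Fin N × K → ℂ) : Fin N × K → ℂ :=
  fun p => ∑ j, ∫ μ, (affinity ε x p.1 j p.2 μ : ℂ) * f (j, μ) ∂(haarProb K)

/-- `(L f)(i, κ) = D_{ii} f(i, κ) - (W f)(i, κ)`. -/
def laplacianFun (ε : ℝ) (x : Fin N → V) (f : Fin N × K → ℂ) : Fin N × K → ℂ :=
  fun p => (degree K ε x p.1 : ℂ) * f p - affinityFun ε x f p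

theorem ae_slice {p : Fin N × K → Prop} (h : ∀ᵐ q ∂(gammaMeasure K N), p q) (j : Fin N) :
    ∀ᵐ μ ∂(haarProb K), p (j, μ) :=
  (Measure.ae_count_iff.1 (Measure.ae_ae_of_ae_prod h)) j

theorem integrable_slice {f : Fin N × K → ℂ} (h : Integrable f (gammaMeasure K N)) (j : Fin N) :
    Integrable (fun μ => f (j, μ)) (haarProb K) :=
  (Measure.ae_count_iff.1 (Integrable.prod_right_ae h)) j

theorem GammaL2.integrable_slice (f : GammaL2 K N) (j : Fin N) :
    Integrable (fun μ => f (j, μ)) (haarProb K) :=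
  InvariantGraphLaplacian.integrable_slice ((Lp.memLp f).integrable (by norm_num)) j

theorem continuous_integral_mul {k : K × K → ℝ} (hk : Continuous k) {g : K → ℂ}
    (hg : Integrable g (haarProb K)) :
    Continuous fun κ => ∫ μ, (k (κ, μ) : ℂ) * g μ ∂(haarProb K) := by
  have hint : ∀ κ, Integrable (fun μ => (k (κ, μ) : ℂ) * g μ) (haarProb K) := by
    intro κ
    let c : C(K, ℂ) := ⟨fun μ => (k (κ, μ) : ℂ), by fun_prop⟩
    exact hg.bdd_mul (c := ‖c‖)
      (c.continuous.measurable.aestronglyMeasurable)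
      (Filter.Eventually.of_forall fun μ => c.norm_coe_le_norm μ)
  let F : C(K, C(K, ℂ)) := ContinuousMap.curry ⟨fun p : K × K => (k p : ℂ), by fun_prop⟩
  have hF : ∀ κ μ, F κ μ = (k (κ, μ) : ℂ) := fun κ μ => rfl
  rw [continuous_iff_continuousAt]
  intro κ₀
  rw [ContinuousAt, tendsto_iff_norm_sub_tendsto_zero]
  have h0 : Filter.Tendsto (fun κ => ‖F κ - F κ₀‖ * ∫ μ, ‖g μ‖ ∂(haarProb K)) (nhds κ₀)
      (nhds 0) := by
    have h1 : Continuous fun κ => ‖F κ - F κ₀‖ * ∫ μ, ‖g μ‖ ∂(haarProb K) := by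
      have := F.continuous
      fun_prop
    simpa using h1.tendsto κ₀
  refine squeeze_zero (fun _ => norm_nonneg _) (fun κ => ?_) h0
  rw [← integral_sub (hint κ) (hint κ₀), ← integral_const_mul]
  refine norm_integral_le_of_norm_le (hg.norm.const_mul _) (Filter.Eventually.of_forall fun μ => ?_)
  rw [← sub_mul, norm_mul]
  refine mul_le_mul_of_nonneg_right ?_ (norm_nonneg _)
  rw [← hF, ← hF, ← ContinuousMap.sub_apply]
  exact (F κ - F κ₀).norm_coe_le_norm μ

theorem memLp_of_continuous {f : Fin N × K → ℂ} (hf : Continuous f) :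
    MemLp f 2 (gammaMeasure K N) := by
  let c : C(Fin N × K, ℂ) := ⟨f, hf⟩
  exact MemLp.of_bound hf.measurable.aestronglyMeasurable ‖c‖
    (Filter.Eventually.of_forall fun p => c.norm_coe_le_norm p)

theorem continuous_affinityFun (ε : ℝ) (x : Fin N → V) (f : GammaL2 K N) :
    Continuous (affinityFun ε x (f : Fin N × K → ℂ)) := by
  rw [continuous_prod_of_discrete_left]
  intro i
  refine continuous_finsetSum _ fun j _ => ?_
  exact continuous_integral_mul (continuous_affinity ε x i j) (f.integrable_slice j)

theorem memLp_laplacianFun (ε : ℝ) (x : Fin N → V) (f : GammaL2 K N) :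
    MemLp (laplacianFun ε x (f : Fin N × K → ℂ)) 2 (gammaMeasure K N) := by
  refine MemLp.sub ?_ (memLp_of_continuous (continuous_affinityFun ε x f))
  have hc : Continuous fun p : Fin N × K => (degree K ε x p.1 : ℂ) :=
    (continuous_of_discreteTopology (f := fun i : Fin N => (degree K ε x i : ℂ))).comp
      continuous_fst
  let c : C(Fin N × K, ℂ) := ⟨_, hc⟩
  refine MemLp.of_le_mul (c := ‖c‖) (Lp.memLp f)
    (hc.measurable.aestronglyMeasurable.mul (Lp.aestronglyMeasurable f))
    (Filter.Eventually.of_forall fun p => ?_)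
  rw [norm_mul]
  exact mul_le_mul_of_nonneg_right (c.norm_coe_le_norm p) (norm_nonneg _)

theorem integrable_affinity_mul (ε : ℝ) (x : Fin N → V) (f : GammaL2 K N) (i j : Fin N) (κ : K) :
    Integrable (fun μ => (affinity ε x i j κ μ : ℂ) * f (j, μ)) (haarProb K) := by
  have hk := continuous_affinity (K := K) ε x i j
  have hκ : Continuous fun μ : K => affinity ε x i j κ μ :=
    hk.comp (Continuous.prodMk_right κ)
  let c : C(K, ℂ) := ⟨fun μ => (affinity ε x i j κ μ : ℂ), by fun_prop⟩
  exact (f.integrable_slice j).bdd_mul (c := ‖c‖) (c.continuous.measurable.aestronglyMeasurable)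
    (Filter.Eventually.of_forall fun μ => c.norm_coe_le_norm μ)

/-- The graph Laplacian `L = D - W` on `L²({1, …, N} × K)`. -/
def laplacian (K : Type*) [Group K] [TopologicalSpace K] [IsTopologicalGroup K] [CompactSpace K]
    [MeasurableSpace K] [BorelSpace K] [MulAction K V] [ContinuousSMul K V]
    (ε : ℝ) (x : Fin N → V) : GammaL2 K N →ₗ[ℂ] GammaL2 K N where
  toFun f := (memLp_laplacianFun ε x f).toLp _
  map_add' f g := by
    rw [← MemLp.toLp_add]
    refine MemLp.toLp_congr _ _ ?_
    filter_upwards [Lp.coeFn_add f g] with p hp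
    have hs : ∀ j, ∫ μ, (affinity ε x p.1 j p.2 μ : ℂ) * (f + g : GammaL2 K N) (j, μ)
          ∂(haarProb K) = ∫ μ, (affinity ε x p.1 j p.2 μ : ℂ) * f (j, μ) ∂(haarProb K) +
          ∫ μ, (affinity ε x p.1 j p.2 μ : ℂ) * g (j, μ) ∂(haarProb K) := by
      intro j
      rw [← integral_add (integrable_affinity_mul ε x f p.1 j p.2)
        (integrable_affinity_mul ε x g p.1 j p.2)]
      refine integral_congr_ae ?_
      filter_upwards [ae_slice (Lp.coeFn_add f g) j] with μ hμ
      rw [hμ, Pi.add_apply, mul_add]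
    simp only [laplacianFun, affinityFun, Pi.add_apply, hs, Finset.sum_add_distrib]
    rw [hp, Pi.add_apply]
    ring
  map_smul' c f := by
    rw [RingHom.id_apply, ← MemLp.toLp_const_smul]
    refine MemLp.toLp_congr _ _ ?_
    filter_upwards [Lp.coeFn_smul c f] with p hp
    have hs : ∀ j, ∫ μ, (affinity ε x p.1 j p.2 μ : ℂ) * (c • f : GammaL2 K N) (j, μ)
          ∂(haarProb K) = c * ∫ μ, (affinity ε x p.1 j p.2 μ : ℂ) * f (j, μ) ∂(haarProb K) := by
      intro j
      rw [← integral_const_mul]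
      refine integral_congr_ae ?_
      filter_upwards [ae_slice (Lp.coeFn_smul c f) j] with μ hμ
      rw [hμ, Pi.smul_apply, smul_eq_mul]
      ring
    simp only [laplacianFun, affinityFun, Pi.smul_apply, hs, ← Finset.mul_sum, smul_eq_mul]
    rw [hp, Pi.smul_apply, smul_eq_mul]
    ring

theorem laplacian_coe (ε : ℝ) (x : Fin N → V) (f : GammaL2 K N) :
    laplacian K ε x f =ᵐ[gammaMeasure K N] laplacianFun ε x f :=
  MemLp.coeFn_toLp (memLp_laplacianFun ε x f)

end Laplacian

section Representations

variable {K : Type*} [Group K] [TopologicalSpace K] {N d : ℕ}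

/-- The representation of `K` on `ℂ^d` given by a continuous homomorphism `κ ↦ U(κ)` into the
unitary `d × d` matrices. -/
def matrixRep (U : K →ₜ* Matrix.unitaryGroup (Fin d) ℂ) :
    Representation ℂ K (Fin d → ℂ) where
  toFun κ := Matrix.toLin' (U κ : Matrix (Fin d) (Fin d) ℂ)
  map_one' := by simp [Module.End.one_eq_id]
  map_mul' κ μ := by simp [Module.End.mul_eq_comp]

/-- `(U_ℓ)_ℓ` is a complete list of the irreducible unitary matrix representations of `K`: each
`U_ℓ` is irreducible, and each irreducible continuous unitary matrix representation is equivalent to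
`U_ℓ` for exactly one `ℓ`. -/
structure IsCompleteIrrepList {ι : Type*} {d : ι → ℕ}
    (U : ∀ ℓ, K →ₜ* Matrix.unitaryGroup (Fin (d ℓ)) ℂ) : Prop where
  irreducible : ∀ ℓ, (matrixRep (U ℓ)).IsIrreducible
  existsUnique : ∀ (e : ℕ) (σ : K →ₜ* Matrix.unitaryGroup (Fin e) ℂ),
    (matrixRep σ).IsIrreducible → ∃! ℓ, Nonempty ((matrixRep σ).Equiv (matrixRep (U ℓ)))

/-- `Φ_m(i, κ) = ∑_n U(κ)_{mn} v_{(i, n)}`; the pair `(i, n)` is the position `(i - 1) d + n`. -/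
def eigenFun (U : K →ₜ* Matrix.unitaryGroup (Fin d) ℂ)
    (v : EuclideanSpace ℂ (Fin N × Fin d)) (m : Fin d) : Fin N × K → ℂ :=
  fun p => ∑ n, (U p.2 : Matrix (Fin d) (Fin d) ℂ) m n * v (p.1, n)

theorem continuous_eigenFun (U : K →ₜ* Matrix.unitaryGroup (Fin d) ℂ)
    (v : EuclideanSpace ℂ (Fin N × Fin d)) (m : Fin d) : Continuous (eigenFun U v m) := by
  rw [continuous_prod_of_discrete_left]
  intro i
  refine continuous_finsetSum _ fun n _ => ?_
  have h : Continuous fun κ : K => (U κ : Matrix (Fin d) (Fin d) ℂ) :=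
    continuous_subtype_val.comp U.continuous_toFun
  exact (h.matrix_elem m n).mul (continuous_const (y := v (i, n)))

end Representations

section Fourier

variable {K : Type*} [Group K] [TopologicalSpace K] [IsTopologicalGroup K] [CompactSpace K]
  [MeasurableSpace K] [BorelSpace K]
  {V : Type*} [NormedAddCommGroup V] [MulAction K V]
  {N d : ℕ}

/-- The block matrix `Ŵ` whose `(i, j)` block is `∫_K W_{ij}(1, κ) U(κ) dκ`, computed entrywise. -/
def fourierMatrix (ε : ℝ) (x : Fin N → V) (U : K →ₜ* Matrix.unitaryGroup (Fin d) ℂ) :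
    Matrix (Fin N × Fin d) (Fin N × Fin d) ℂ :=
  Matrix.of fun p q => ∫ κ, (affinity ε x p.1 q.1 (1 : K) κ : ℂ) *
    (U κ : Matrix (Fin d) (Fin d) ℂ) p.2 q.2 ∂(haarProb K)

/-- The matrix `S = D ⊗ I - Ŵ`. -/
def symbolMatrix (ε : ℝ) (x : Fin N → V) (U : K →ₜ* Matrix.unitaryGroup (Fin d) ℂ) :
    Matrix (Fin N × Fin d) (Fin N × Fin d) ℂ :=
  Matrix.diagonal (fun i => (degree K ε x i : ℂ)) ⊗ₖ (1 : Matrix (Fin d) (Fin d) ℂ) -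
    fourierMatrix ε x U

/-- The function `Φ_m` as an element of `L²({1, …, N} × K)`. -/
def eigenLp (U : K →ₜ* Matrix.unitaryGroup (Fin d) ℂ)
    (v : EuclideanSpace ℂ (Fin N × Fin d)) (m : Fin d) : GammaL2 K N :=
  (memLp_of_continuous (continuous_eigenFun U v m)).toLp _

/-- `v_1, …, v_{Nd}` are orthonormal eigenvectors of `S` with (real) eigenvalues
`lam_1, …, lam_{Nd}`. -/
structure IsEigenSystem (S : Matrix (Fin N × Fin d) (Fin N × Fin d) ℂ)
    (lam : Fin (N * d) → ℝ) (v : Fin (N * d) → EuclideanSpace ℂ (Fin N × Fin d)) : Prop where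
  orthonormal : Orthonormal ℂ v
  eigen : ∀ s, S *ᵥ (v s).ofLp = (lam s : ℂ) • (v s).ofLp

end Fourier

end InvariantGraphLaplacian

end

open InvariantGraphLaplacian

/-! Since the action is isometric, `affinity` is unchanged when both group arguments are multiplied
on the left by the same element. Substituting μ = κν in W applied to Φ_m therefore splits off U(κ):
the operator acts on a row of U times a vector v only through v, and L Φ_m(v) = Φ_m(S v)
(`laplacian_eigenLp`). Eigenvectors of S thus give eigenfunctions of L.

The Schur relations give ⟨Φ_m(v), Φ_m'(w)⟩ = δ_{mm'} ⟨v, w⟩ / d within one representation and 0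
between inequivalent ones, hence orthogonality and nonvanishing. Density is Peter–Weyl on each slice
{i} × K (`coeffSpan_orthogonal_eq_bot`). It makes the list of eigenvalues exhaustive: by symmetry of
L, an eigenfunction for z is orthogonal to every Φ whose eigenvalue differs from z, and it cannot be
orthogonal to all of them.

Peter–Weyl is derived from completeness of the list. Convolution with a hermitian kernel is compact,
symmetric, and preserves the orthogonal complement of the matrix coefficients. A nonzero eigenvalue
there would give a nonzero finite-dimensional, right-translation-invariant space of continuous
functions. A minimal invariant subspace of it is irreducible, hence consists of coefficients of some
U_ℓ, and so is orthogonal to itself. All convolutions therefore vanish on the complement, which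
forces it to be zero.

Positivity of L is |ab| ≤ (a² + b²)/2 weighted by W, using that ∫ W_ij(κ, μ) dμ does not depend on
κ. -/

namespace InvariantGraphLaplacian

/-! ### Right and inversion invariance of Haar measure -/

section HaarInvariance

variable (K : Type*) [Group K] [TopologicalSpace K] [IsTopologicalGroup K] [CompactSpace K]
  [MeasurableSpace K] [BorelSpace K]

instance : (haarProb K).IsHaarMeasure := by
  unfold haarProb; infer_instance

/-- Haar measure is unique up to a scalar, and total mass 1 fixes the scalar. Applied to the images
of Haar measure under right translations and inversion. -/
theorem eq_haarProb_of_isMulLeftInvariant (μ : Measure K) [IsProbabilityMeasure μ]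
    [μ.IsMulLeftInvariant] : μ = haarProb K := by
  have h := Measure.isMulInvariant_eq_smul_of_compactSpace μ (haarProb K)
  have h1 := congrArg (fun ν : Measure K => ν Set.univ) h
  simp only [measure_univ, Measure.smul_apply, ENNReal.smul_def, smul_eq_mul, mul_one] at h1
  rw [h, show Measure.haarScalarFactor μ (haarProb K) = 1 by exact_mod_cast h1.symm, one_smul]

instance : (haarProb K).IsMulRightInvariant where
  map_mul_right_eq_self g := by
    have := isMulLeftInvariant_map_mul_right (μ := haarProb K) g
    have : IsProbabilityMeasure (Measure.map (· * g) (haarProb K)) :=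
      Measure.isProbabilityMeasure_map (measurable_mul_const g).aemeasurable
    exact eq_haarProb_of_isMulLeftInvariant K _

instance : (haarProb K).IsInvInvariant where
  inv_eq_self := by
    have : IsProbabilityMeasure (haarProb K).inv :=
      Measure.isProbabilityMeasure_map measurable_inv.aemeasurable
    have : ((haarProb K).inv).IsMulLeftInvariant := inferInstance
    exact eq_haarProb_of_isMulLeftInvariant K _

end HaarInvariance

/-! ### Compactness of operators given by continuous families of vectors -/

section CompactKernel

variable {X H : Type*} [TopologicalSpace X] [CompactSpace X] [NormedAddCommGroup H]
  [InnerProductSpace ℂ H]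

/-- The operator `f ↦ (g ↦ ⟪F g, f⟫)` attached to a continuous family `F` of vectors. -/
noncomputable def innerOperator (F : C(X, H)) : H →L[ℂ] C(X, ℂ) :=
  LinearMap.mkContinuous
    { toFun := fun f => ⟨fun g => inner ℂ (F g) f, by fun_prop⟩
      map_add' := fun f₁ f₂ => by ext g; simp
      map_smul' := fun c f => by ext g; simp } ‖F‖ fun f => by
    rw [ContinuousMap.norm_le _ (by positivity)]
    intro g
    exact (norm_inner_le_norm _ _).trans
      (mul_le_mul_of_nonneg_right (F.norm_coe_le_norm g) (norm_nonneg _))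

theorem innerOperator_apply (F : C(X, H)) (f : H) (g : X) :
    innerOperator F f g = inner ℂ (F g) f := rfl

/-- Arzelà–Ascoli: images of the unit ball are bounded by ‖F‖ and, by Cauchy–Schwarz, share the
modulus of continuity ‖F g - F g'‖. -/
theorem isCompactOperator_innerOperator (F : C(X, H)) : IsCompactOperator (innerOperator F) := by
  -- Both conditions are pointwise closed, so Tychonoff makes `P` compact in the product topology;
  -- the second one makes its members equicontinuous.
  let P : Set (X → ℂ) := {f | (∀ g, f g ∈ Metric.closedBall (0 : ℂ) ‖F‖) ∧
    ∀ g g', ‖f g - f g'‖ ≤ ‖F g - F g'‖}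
  have hP : IsCompact P := by
    refine (isCompact_univ_pi fun _ : X => isCompact_closedBall (0 : ℂ) ‖F‖).of_isClosed_subset ?_
      fun f hf g _ => hf.1 g
    refine IsClosed.inter (s₁ := {f : X → ℂ | ∀ g, f g ∈ Metric.closedBall (0 : ℂ) ‖F‖})
      (s₂ := {f : X → ℂ | ∀ g g', ‖f g - f g'‖ ≤ ‖F g - F g'‖}) ?_ ?_
    · simp only [Set.ofPred_forall]
      exact isClosed_iInter fun g => Metric.isClosed_closedBall.preimage (continuous_apply g)
    · simp only [Set.ofPred_forall]
      refine isClosed_iInter fun g => isClosed_iInter fun g' => isClosed_le ?_ continuous_const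
      fun_prop
  have hequi : ∀ f ∈ P, Continuous f := by
    intro f hf
    rw [continuous_iff_continuousAt]
    intro g
    rw [ContinuousAt, tendsto_iff_norm_sub_tendsto_zero]
    have h : Continuous fun g' => ‖F g' - F g‖ := by fun_prop
    exact squeeze_zero (fun _ => norm_nonneg _) (fun g' => hf.2 g' g) (by simpa using h.tendsto g)
  let S : Set C(X, ℂ) := {φ | (φ : X → ℂ) ∈ P}
  have hS : IsCompact S := by
    refine ArzelaAscoli.isCompact_of_equicontinuous S ?_ ?_
    · convert hP
      ext f
      exact ⟨fun ⟨φ, hφ, h⟩ => h ▸ hφ, fun hf => ⟨⟨f, hequi f hf⟩, hf, rfl⟩⟩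
    · intro g
      refine Metric.equicontinuousAt_iff_right.2 fun e he => ?_
      have h : Continuous fun g' => ‖F g' - F g‖ := by fun_prop
      have h0 : Filter.Tendsto (fun g' => ‖F g' - F g‖) (nhds g) (nhds 0) := by
        simpa using h.tendsto g
      filter_upwards [h0.eventually (gt_mem_nhds he)] with g' hg' φ
      rw [dist_comm, dist_eq_norm]
      exact (φ.2.2 g' g).trans_lt hg'
  refine ⟨S, hS, Filter.mem_of_superset (Metric.closedBall_mem_nhds (0 : H) one_pos) ?_⟩
  intro f hf
  have hf1 : ‖f‖ ≤ 1 := by simpa using hf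
  refine ⟨fun g => ?_, fun g g' => ?_⟩
  · rw [mem_closedBall_zero_iff, innerOperator_apply]
    calc _ ≤ ‖F g‖ * ‖f‖ := norm_inner_le_norm _ _
      _ ≤ ‖F‖ * 1 := by gcongr; exact F.norm_coe_le_norm g
      _ = ‖F‖ := mul_one _
  · rw [innerOperator_apply, innerOperator_apply, ← inner_sub_left]
    calc _ ≤ ‖F g - F g'‖ * ‖f‖ := norm_inner_le_norm _ _
      _ ≤ ‖F g - F g'‖ * 1 := by gcongr
      _ = _ := mul_one _

end CompactKernel

/-! ### Schur orthogonality relations -/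

section Schur

variable {K : Type*} [Group K] [TopologicalSpace K] {d e : ℕ}

@[simp]
theorem matrixRep_apply (U : K →ₜ* Matrix.unitaryGroup (Fin d) ℂ) (κ : K) (c : Fin d → ℂ) :
    matrixRep U κ c = (U κ : Matrix (Fin d) (Fin d) ℂ) *ᵥ c :=
  Matrix.toLin'_apply _ _

theorem continuous_entry (U : K →ₜ* Matrix.unitaryGroup (Fin d) ℂ) (m n : Fin d) :
    Continuous fun κ : K => (U κ : Matrix (Fin d) (Fin d) ℂ) m n :=
  (continuous_subtype_val.comp U.continuous_toFun).matrix_elem m n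

theorem entry_mul (U : K →ₜ* Matrix.unitaryGroup (Fin d) ℂ) (κ μ : K) (m n : Fin d) :
    (U (κ * μ) : Matrix (Fin d) (Fin d) ℂ) m n =
      ∑ p, (U κ : Matrix (Fin d) (Fin d) ℂ) m p * (U μ : Matrix (Fin d) (Fin d) ℂ) p n := by
  rw [map_mul, Submonoid.coe_mul, Matrix.mul_apply]

theorem entry_inv (U : K →ₜ* Matrix.unitaryGroup (Fin d) ℂ) (κ : K) (m n : Fin d) :
    (U κ⁻¹ : Matrix (Fin d) (Fin d) ℂ) m n = conj ((U κ : Matrix (Fin d) (Fin d) ℂ) n m) := by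
  have h : U κ⁻¹ = (U κ)⁻¹ := eq_inv_of_mul_eq_one_left (by rw [← map_mul]; simp)
  rw [h]
  rfl

theorem sum_entry_mul_conj_entry (U : K →ₜ* Matrix.unitaryGroup (Fin d) ℂ) (κ : K) (n n' : Fin d) :
    ∑ m, (U κ : Matrix (Fin d) (Fin d) ℂ) m n * conj ((U κ : Matrix (Fin d) (Fin d) ℂ) m n') =
      if n = n' then 1 else 0 := by
  have h := entry_mul U κ⁻¹ κ n' n
  rw [inv_mul_cancel, map_one, OneMemClass.coe_one, Matrix.one_apply] at h
  simp only [entry_inv] at h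
  simp only [eq_comm (a := n)]
  rw [h]
  exact Finset.sum_congr rfl fun _ _ => mul_comm _ _

variable [IsTopologicalGroup K] [CompactSpace K] [MeasurableSpace K] [BorelSpace K]

theorem integrable_of_continuous {f : K → ℂ} (hf : Continuous f) : Integrable f (haarProb K) :=
  hf.integrable_of_hasCompactSupport (HasCompactSupport.of_compactSpace f)

/-- The matrix `∫ U(κ)_{mn} conj V(κ)_{m'n'} dκ`, indexed by `m` and `m'`. -/
noncomputable def schurMatrix (U : K →ₜ* Matrix.unitaryGroup (Fin d) ℂ)
    (V : K →ₜ* Matrix.unitaryGroup (Fin e) ℂ) (n : Fin d) (n' : Fin e) :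
    Matrix (Fin d) (Fin e) ℂ :=
  Matrix.of fun m m' => ∫ κ, (U κ : Matrix (Fin d) (Fin d) ℂ) m n *
    conj ((V κ : Matrix (Fin e) (Fin e) ℂ) m' n') ∂(haarProb K)

/-- Left invariance moves g from U(gκ) to V(g⁻¹κ), and unitarity turns the conjugate of V(g⁻¹) into
V(g). The averaged matrix thus intertwines V with U. -/
theorem mul_schurMatrix (U : K →ₜ* Matrix.unitaryGroup (Fin d) ℂ)
    (V : K →ₜ* Matrix.unitaryGroup (Fin e) ℂ) (n : Fin d) (n' : Fin e) (g : K) :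
    (U g : Matrix (Fin d) (Fin d) ℂ) * schurMatrix U V n n' =
      schurMatrix U V n n' * (V g : Matrix (Fin e) (Fin e) ℂ) := by
  have hc : ∀ m m', Continuous fun κ => (U κ : Matrix (Fin d) (Fin d) ℂ) m n *
      conj ((V κ : Matrix (Fin e) (Fin e) ℂ) m' n') := fun m m' =>
    (continuous_entry U m n).mul (Complex.continuous_conj.comp (continuous_entry V m' n'))
  ext m m'
  simp only [Matrix.mul_apply, schurMatrix, Matrix.of_apply]
  calc ∑ p, (U g : Matrix (Fin d) (Fin d) ℂ) m p * ∫ κ, (U κ : Matrix (Fin d) (Fin d) ℂ) p n *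
        conj ((V κ : Matrix (Fin e) (Fin e) ℂ) m' n') ∂(haarProb K)
      = ∫ κ, (U (g * κ) : Matrix (Fin d) (Fin d) ℂ) m n *
          conj ((V κ : Matrix (Fin e) (Fin e) ℂ) m' n') ∂(haarProb K) := by
        simp only [← integral_const_mul]
        rw [← integral_finsetSum _ fun p _ => integrable_of_continuous ((hc p m').const_mul _)]
        congr 1 with κ
        rw [entry_mul, Finset.sum_mul]
        exact Finset.sum_congr rfl fun _ _ => by ring
    _ = ∫ κ, (U κ : Matrix (Fin d) (Fin d) ℂ) m n *
          conj ((V (g⁻¹ * κ) : Matrix (Fin e) (Fin e) ℂ) m' n') ∂(haarProb K) := by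
        rw [← integral_mul_left_eq_self _ g⁻¹]
        simp
    _ = _ := by
        simp only [← integral_mul_const]
        rw [← integral_finsetSum _ fun p _ => integrable_of_continuous ((hc m p).mul_const _)]
        congr 1 with κ
        rw [entry_mul, map_sum, Finset.mul_sum]
        refine Finset.sum_congr rfl fun p _ => ?_
        rw [entry_inv, map_mul, Complex.conj_conj]
        ring

/-- The matrix of integrals as an intertwining map. -/
noncomputable def schurIntertwiner (U : K →ₜ* Matrix.unitaryGroup (Fin d) ℂ)
    (V : K →ₜ* Matrix.unitaryGroup (Fin e) ℂ) (n : Fin d) (n' : Fin e) :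
    (matrixRep V).IntertwiningMap (matrixRep U) :=
  (Matrix.toLin' (schurMatrix U V n n')).intertwiningMap_of_isIntertwiningMap _ _ fun g c => by
    simp only [matrixRep_apply, Matrix.toLin'_apply, Matrix.mulVec_mulVec, mul_schurMatrix]

theorem schurIntertwiner_apply (U : K →ₜ* Matrix.unitaryGroup (Fin d) ℂ)
    (V : K →ₜ* Matrix.unitaryGroup (Fin e) ℂ) (n : Fin d) (n' : Fin e) (c : Fin e → ℂ) :
    schurIntertwiner U V n n' c = schurMatrix U V n n' *ᵥ c :=
  Matrix.toLin'_apply _ _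

/-- Matrix coefficients of inequivalent irreducible representations are orthogonal. -/
theorem integral_entry_mul_conj_eq_zero (U : K →ₜ* Matrix.unitaryGroup (Fin d) ℂ)
    (V : K →ₜ* Matrix.unitaryGroup (Fin e) ℂ) (hU : (matrixRep U).IsIrreducible)
    (hV : (matrixRep V).IsIrreducible) (h : IsEmpty ((matrixRep V).Equiv (matrixRep U)))
    (m n : Fin d) (m' n' : Fin e) :
    ∫ κ, (U κ : Matrix (Fin d) (Fin d) ℂ) m n *
      conj ((V κ : Matrix (Fin e) (Fin e) ℂ) m' n') ∂(haarProb K) = 0 := by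
  -- Schur's lemma enters as an instance: between inequivalent irreducibles the intertwining maps
  -- form a subsingleton.
  have h0 : schurIntertwiner U V n n' = 0 := Subsingleton.elim _ _
  have h1 : schurMatrix U V n n' *ᵥ Pi.single m' 1 = 0 := by
    rw [← schurIntertwiner_apply, h0]; rfl
  simpa [schurMatrix] using congrFun h1 m

/-- The Schur orthogonality relations for an irreducible representation. -/
theorem integral_entry_mul_conj_self (U : K →ₜ* Matrix.unitaryGroup (Fin d) ℂ)
    (hU : (matrixRep U).IsIrreducible) (m n m' n' : Fin d) :
    ∫ κ, (U κ : Matrix (Fin d) (Fin d) ℂ) m n *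
      conj ((U κ : Matrix (Fin d) (Fin d) ℂ) m' n') ∂(haarProb K) =
      if m = m' ∧ n = n' then (d : ℂ)⁻¹ else 0 := by
  -- Over ℂ a self-intertwiner is a scalar c; its trace c·d is computed below from orthonormality of
  -- the columns of U(κ).
  obtain ⟨c, hc⟩ := Representation.IsIrreducible.algebraMap_intertwiningMap_bijective_of_isAlgClosed.2
    (schurIntertwiner U U n n')
  have hmat : schurMatrix U U n n' = c • (1 : Matrix (Fin d) (Fin d) ℂ) := by
    apply Matrix.toLin'.injective
    refine LinearMap.ext fun w => ?_
    rw [Matrix.toLin'_apply, ← schurIntertwiner_apply, ← hc, map_smul, Matrix.toLin'_one]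
    rfl
  have htr : (schurMatrix U U n n').trace = if n = n' then 1 else 0 := by
    simp only [Matrix.trace, Matrix.diag, schurMatrix, Matrix.of_apply]
    have hint : ∀ p, Integrable (fun κ => (U κ : Matrix (Fin d) (Fin d) ℂ) p n *
        conj ((U κ : Matrix (Fin d) (Fin d) ℂ) p n')) (haarProb K) := fun p =>
      integrable_of_continuous
        ((continuous_entry U p n).mul (Complex.continuous_conj.comp (continuous_entry U p n')))
    rw [← integral_finsetSum _ fun p _ => hint p]
    simp only [sum_entry_mul_conj_entry, integral_const, probReal_univ, one_smul]
  have hd : (d : ℂ) ≠ 0 := by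
    have : 0 < d := m.pos
    exact_mod_cast this.ne'
  have hcd : c * d = if n = n' then 1 else 0 := by
    rw [← htr, hmat]; simp
  have hent := congrFun (congrFun hmat m) m'
  simp only [schurMatrix, Matrix.of_apply, Matrix.smul_apply, Matrix.one_apply, smul_eq_mul] at hent
  rw [hent]
  by_cases h1 : m = m' <;> by_cases h2 : n = n'
  · rw [if_pos h1, if_pos ⟨h1, h2⟩, mul_one]
    exact eq_inv_of_mul_eq_one_left (by rw [hcd, if_pos h2])
  · rw [if_neg h2] at hcd
    rw [(mul_eq_zero.1 hcd).resolve_right hd, zero_mul, if_neg fun h : m = m' ∧ n = n' => h2 h.2]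
  all_goals rw [if_neg h1, if_neg fun h : m = m' ∧ n = n' => h1 h.1, mul_zero]

end Schur

/-! ### Translation-invariant spaces of continuous functions -/

section Translation

variable {K : Type*} [Group K] [TopologicalSpace K] [IsTopologicalGroup K]

/-- Right translation `(R_κ φ)(g) = φ(g κ)` on continuous functions. -/
noncomputable def rightTranslate (κ : K) : C(K, ℂ) →ₗ[ℂ] C(K, ℂ) where
  toFun φ := ⟨fun g => φ (g * κ), by fun_prop⟩
  map_add' _ _ := rfl
  map_smul' _ _ := rfl

@[simp]
theorem rightTranslate_apply (κ : K) (φ : C(K, ℂ)) (g : K) : rightTranslate κ φ g = φ (g * κ) := rfl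

theorem rightTranslate_mul (κ μ : K) (φ : C(K, ℂ)) :
    rightTranslate (κ * μ) φ = rightTranslate κ (rightTranslate μ φ) := by
  ext g; simp [mul_assoc]

theorem rightTranslate_one (φ : C(K, ℂ)) : rightTranslate (1 : K) φ = φ := by
  ext g; simp

theorem continuous_rightTranslate (φ : C(K, ℂ)) : Continuous fun κ : K => rightTranslate κ φ :=
  (ContinuousMap.curry ⟨fun p : K × K => φ (p.2 * p.1), by fun_prop⟩).continuous

/-- Every nonzero finite-dimensional translation invariant space of continuous functions contains a
minimal one. -/
theorem exists_minimal_invariant (E : Submodule ℂ C(K, ℂ)) [FiniteDimensional ℂ E] (hE : E ≠ ⊥)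
    (hinv : ∀ κ : K, ∀ φ ∈ E, rightTranslate κ φ ∈ E) :
    ∃ E₀ ≤ E, E₀ ≠ ⊥ ∧ (∀ κ : K, ∀ φ ∈ E₀, rightTranslate κ φ ∈ E₀) ∧
      ∀ E' ≤ E₀, (∀ κ : K, ∀ φ ∈ E', rightTranslate κ φ ∈ E') → E' = ⊥ ∨ E' = E₀ := by
  induction hn : Module.finrank ℂ E using Nat.strong_induction_on generalizing E with
  | _ n ih =>
    by_cases h : ∀ E' ≤ E, (∀ κ : K, ∀ φ ∈ E', rightTranslate κ φ ∈ E') → E' = ⊥ ∨ E' = E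
    · exact ⟨E, le_rfl, hE, hinv, h⟩
    · push Not at h
      obtain ⟨E', hle, hinv', hne, hne'⟩ := h
      have hfin : FiniteDimensional ℂ E' := Submodule.finiteDimensional_of_le hle
      obtain ⟨E₀, h₀, h⟩ := ih _ (hn ▸ Submodule.finrank_lt_finrank_of_lt (lt_of_le_of_ne hle hne'))
        E' hne hinv' rfl
      exact ⟨E₀, h₀.trans hle, h⟩

/-- The injective intertwiner `Ψ` carries subrepresentations of σ to invariant subspaces of its
range, where minimality applies. -/
theorem isIrreducible_of_minimal {e : ℕ} (σ : K →ₜ* Matrix.unitaryGroup (Fin e) ℂ)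
    (Ψ : (Fin e → ℂ) →ₗ[ℂ] C(K, ℂ)) (hΨ : Function.Injective Ψ)
    (hσ : ∀ κ c, Ψ (matrixRep σ κ c) = rightTranslate κ (Ψ c))
    (hne : LinearMap.range Ψ ≠ ⊥)
    (hmin : ∀ E' ≤ LinearMap.range Ψ, (∀ κ : K, ∀ φ ∈ E', rightTranslate κ φ ∈ E') →
      E' = ⊥ ∨ E' = LinearMap.range Ψ) : (matrixRep σ).IsIrreducible where
  exists_pair_ne := by
    refine ⟨⊥, ⊤, fun h => hne ?_⟩
    have h' : (⊥ : Submodule ℂ (Fin e → ℂ)) = ⊤ :=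
      congrArg Subrepresentation.toSubmodule h
    rw [LinearMap.range_eq_map, ← h', Submodule.map_bot]
  eq_bot_or_eq_top S := by
    rcases hmin (S.toSubmodule.map Ψ) LinearMap.map_le_range (by
      rintro κ _ ⟨c, hc, rfl⟩
      exact ⟨matrixRep σ κ c, S.apply_mem_toSubmodule κ hc, hσ κ c⟩) with h | h
    · left
      apply Subrepresentation.toSubmodule_injective
      exact Submodule.map_injective_of_injective hΨ (h.trans (Submodule.map_bot Ψ).symm)
    · right
      apply Subrepresentation.toSubmodule_injective
      exact Submodule.map_injective_of_injective hΨ (h.trans (LinearMap.range_eq_map Ψ))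

end Translation

/-! ### Matrix coefficients -/

section Coefficients

variable {K : Type*} [Group K] [TopologicalSpace K] {d : ℕ}

/-- The matrix coefficient `U(κ)_{mn}` as a continuous function. -/
noncomputable def coeff (U : K →ₜ* Matrix.unitaryGroup (Fin d) ℂ) (m n : Fin d) :
    C(K, ℂ) :=
  ⟨fun κ => (U κ : Matrix (Fin d) (Fin d) ℂ) m n, continuous_entry U m n⟩

@[simp]
theorem coeff_apply (U : K →ₜ* Matrix.unitaryGroup (Fin d) ℂ) (m n : Fin d) (κ : K) :
    coeff U m n κ = (U κ : Matrix (Fin d) (Fin d) ℂ) m n := rfl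

end Coefficients

/-! ### From invariant function spaces to unitary matrix representations -/

section MatrixForm

variable {K : Type*} [Group K] [TopologicalSpace K] [IsTopologicalGroup K] [CompactSpace K]
  [MeasurableSpace K] [BorelSpace K]

/-- The inclusion of the continuous functions into `L²(K)`. -/
noncomputable abbrev toL2 : C(K, ℂ) →L[ℂ] Lp ℂ 2 (haarProb K) :=
  ContinuousMap.toLp 2 (haarProb K) ℂ

theorem toL2_injective : Function.Injective (toL2 (K := K)) :=
  ContinuousMap.toLp_injective (haarProb K)

theorem inner_toL2 (φ ψ : C(K, ℂ)) :
    inner ℂ (toL2 φ) (toL2 ψ) = ∫ κ, ψ κ * conj (φ κ) ∂(haarProb K) :=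
  ContinuousMap.inner_toLp (haarProb K) φ ψ

theorem inner_toL2_rightTranslate (κ : K) (φ ψ : C(K, ℂ)) :
    inner ℂ (toL2 (rightTranslate κ φ)) (toL2 (rightTranslate κ ψ)) =
      inner ℂ (toL2 φ) (toL2 ψ) := by
  rw [inner_toL2, inner_toL2]
  exact integral_mul_right_eq_self (fun g => ψ g * conj (φ g)) κ

/-- An orthonormal basis of the image of `E` in L² is lifted back to continuous functions;
injectivity of `toL2` returns the expansion to C(K). -/
theorem exists_orthonormal_span (E : Submodule ℂ C(K, ℂ)) [FiniteDimensional ℂ E] :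
    ∃ (e : ℕ) (b : Fin e → C(K, ℂ)), Orthonormal ℂ (fun i => toL2 (b i)) ∧
      Submodule.span ℂ (Set.range b) = E := by
  let E₂ : Submodule ℂ (Lp ℂ 2 (haarProb K)) := E.map (toL2 (K := K)).toLinearMap
  let B := stdOrthonormalBasis ℂ E₂
  have hB : ∀ i, ∃ φ ∈ E, toL2 φ = (B i : Lp ℂ 2 (haarProb K)) := fun i =>
    Submodule.mem_map.1 (B i).2
  choose b hbE hb using hB
  refine ⟨_, b, ?_, ?_⟩
  · simp only [hb]
    exact B.orthonormal.comp_linearIsometry E₂.subtypeₗᵢ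
  · refine le_antisymm (Submodule.span_le.2 (Set.range_subset_iff.2 hbE)) fun φ hφ => ?_
    have h := B.sum_repr ⟨toL2 φ, Submodule.mem_map_of_mem hφ⟩
    have h' := congrArg (Subtype.val : E₂ → _) h
    rw [AddSubmonoidClass.coe_finsetSum] at h'
    simp only [Submodule.coe_smul, ← hb, ← map_smul, ← map_sum] at h'
    rw [← toL2_injective h']
    exact Submodule.sum_mem _ fun i _ => Submodule.smul_mem _ _ (Submodule.subset_span ⟨i, rfl⟩)

theorem eq_sum_inner_smul {e : ℕ} {b : Fin e → C(K, ℂ)} (hb : Orthonormal ℂ fun i => toL2 (b i))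
    {φ : C(K, ℂ)} (hφ : φ ∈ Submodule.span ℂ (Set.range b)) :
    φ = ∑ i, inner ℂ (toL2 (b i)) (toL2 φ) • b i := by
  obtain ⟨c, rfl⟩ := (Submodule.mem_span_range_iff_exists_fun ℂ).1 hφ
  refine Finset.sum_congr rfl fun i _ => ?_
  rw [map_sum]
  simp only [map_smul]
  rw [hb.inner_right_fintype]

/-- A finite-dimensional translation invariant space of continuous functions carries a unitary matrix
representation. -/
theorem exists_matrix_of_invariant (E : Submodule ℂ C(K, ℂ)) [FiniteDimensional ℂ E]
    (hinv : ∀ κ : K, ∀ φ ∈ E, rightTranslate κ φ ∈ E) :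
    ∃ (e : ℕ) (σ : K →ₜ* Matrix.unitaryGroup (Fin e) ℂ) (Ψ : (Fin e → ℂ) →ₗ[ℂ] C(K, ℂ)),
      Function.Injective Ψ ∧ LinearMap.range Ψ = E ∧
      ∀ κ c, Ψ (matrixRep σ κ c) = rightTranslate κ (Ψ c) := by
  obtain ⟨e, b, hb, hspan⟩ := exists_orthonormal_span E
  -- The matrix of right translation in the basis `b`; it is unitary because right translation
  -- preserves the L² inner product.
  let s : K → Matrix (Fin e) (Fin e) ℂ := fun κ =>
    Matrix.of fun i j => inner ℂ (toL2 (b i)) (toL2 (rightTranslate κ (b j)))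
  have hs : ∀ κ i j, s κ i j = inner ℂ (toL2 (b i)) (toL2 (rightTranslate κ (b j))) :=
    fun _ _ _ => rfl
  have hbE : ∀ j, b j ∈ E := fun j => hspan ▸ Submodule.subset_span ⟨j, rfl⟩
  have hexp : ∀ κ j, rightTranslate κ (b j) = ∑ i, s κ i j • b i := fun κ j =>
    eq_sum_inner_smul hb (hspan.symm ▸ hinv κ _ (hbE j))
  have hmul : ∀ κ μ, s (κ * μ) = s κ * s μ := by
    intro κ μ
    ext i j
    rw [hs, rightTranslate_mul, hexp μ j, map_sum, map_sum, inner_sum, Matrix.mul_apply]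
    refine Finset.sum_congr rfl fun p _ => ?_
    rw [map_smul, map_smul, inner_smul_right, hs κ, mul_comm]
  have hone : s 1 = 1 := by
    ext i j
    rw [hs, rightTranslate_one, orthonormal_iff_ite.1 hb, Matrix.one_apply]
  have hunit : ∀ κ, s κ ∈ Matrix.unitaryGroup (Fin e) ℂ := by
    intro κ
    rw [Matrix.mem_unitaryGroup_iff']
    ext i j
    rw [Matrix.one_apply, ← orthonormal_iff_ite.1 hb i j, ← inner_toL2_rightTranslate κ,
      hexp κ j, map_sum, inner_sum, Matrix.mul_apply]
    refine Finset.sum_congr rfl fun p _ => ?_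
    rw [map_smul, inner_smul_right, Matrix.star_apply, hs κ p i, ← inner_conj_symm, mul_comm]
    simp
  have hcont : Continuous fun κ => s κ := by
    refine continuous_matrix fun i j => ?_
    have := continuous_rightTranslate (K := K) (b j)
    simp only [hs]
    fun_prop
  let σ : K →ₜ* Matrix.unitaryGroup (Fin e) ℂ :=
    { toFun := fun κ => ⟨s κ, hunit κ⟩
      map_one' := Subtype.ext hone
      map_mul' := fun κ μ => Subtype.ext (hmul κ μ)
      continuous_toFun := hcont.subtype_mk hunit }
  let Ψ : (Fin e → ℂ) →ₗ[ℂ] C(K, ℂ) := Fintype.linearCombination ℂ b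
  have hΨ : ∀ c, Ψ c = ∑ i, c i • b i := fun c => Fintype.linearCombination_apply ℂ b c
  refine ⟨e, σ, Ψ, ?_, ?_, ?_⟩
  · have hli : LinearIndependent ℂ b :=
      LinearIndependent.of_comp (toL2 (K := K)).toLinearMap hb.linearIndependent
    exact linearIndependent_iff_injective_fintypeLinearCombination.1 hli
  · rw [Fintype.range_linearCombination, hspan]
  · intro κ c
    rw [hΨ, hΨ, map_sum, matrixRep_apply]
    simp only [map_smul, hexp, Finset.smul_sum, smul_smul, Matrix.mulVec, dotProduct,
      Finset.sum_smul]
    rw [Finset.sum_comm]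
    refine Finset.sum_congr rfl fun j _ => Finset.sum_congr rfl fun i _ => ?_
    rw [mul_comm]
    rfl

variable {ι : Type*} {d : ι → ℕ} {U : ∀ ℓ, K →ₜ* Matrix.unitaryGroup (Fin (d ℓ)) ℂ}

/-- The functions in a minimal invariant space are combinations of matrix coefficients. -/
theorem exists_mem_span_coeff (hU : IsCompleteIrrepList U) (E : Submodule ℂ C(K, ℂ))
    [FiniteDimensional ℂ E] (hE : E ≠ ⊥) (hinv : ∀ κ : K, ∀ φ ∈ E, rightTranslate κ φ ∈ E)
    (hmin : ∀ E' ≤ E, (∀ κ : K, ∀ φ ∈ E', rightTranslate κ φ ∈ E') → E' = ⊥ ∨ E' = E) :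
    ∃ ℓ, ∀ φ ∈ E, φ ∈ Submodule.span ℂ
      (Set.range fun p : Fin (d ℓ) × Fin (d ℓ) => coeff (U ℓ) p.1 p.2) := by
  obtain ⟨e, σ, Ψ, hΨ, rfl, hσ⟩ := exists_matrix_of_invariant E hinv
  obtain ⟨ℓ, ⟨F⟩, -⟩ := hU.existsUnique e σ (isIrreducible_of_minimal σ Ψ hΨ hσ hE hmin)
  refine ⟨ℓ, ?_⟩
  rintro _ ⟨c, rfl⟩
  -- Since φ(κ) = (R_κ φ)(1), evaluation at 1, carried over to ℂ^d, recovers Ψ c κ as a linear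
  -- functional of U_ℓ(κ) F(c), hence as a combination of entries.
  let Λ : (Fin (d ℓ) → ℂ) →ₗ[ℂ] ℂ :=
    (ContinuousMap.evalCLM ℂ (1 : K)).toLinearMap ∘ₗ Ψ ∘ₗ F.symm.toLinearMap
  have h : Ψ c = ∑ p : Fin (d ℓ) × Fin (d ℓ),
      (F c p.2 * Λ (Pi.single p.1 1)) • coeff (U ℓ) p.1 p.2 := by
    ext κ
    have h1 : Ψ c κ = Λ (matrixRep (U ℓ) κ (F c)) := by
      have h2 : F.symm (matrixRep (U ℓ) κ (F c)) = matrixRep σ κ c := by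
        have h3 := Representation.IntertwiningMap.isIntertwining _ _ F.toIntertwiningMap κ c
        change F (matrixRep σ κ c) = matrixRep (U ℓ) κ (F c) at h3
        rw [← h3]
        exact F.symm_apply_apply _
      change _ = Ψ (F.symm (matrixRep (U ℓ) κ (F c))) 1
      rw [h2, hσ]
      simp
    rw [h1, LinearMap.pi_apply_eq_sum_univ Λ, ContinuousMap.sum_apply, Fintype.sum_prod_type]
    refine Finset.sum_congr rfl fun m _ => ?_
    simp only [matrixRep_apply, Matrix.mulVec, dotProduct, smul_eq_mul, Finset.sum_mul,
      ContinuousMap.smul_apply, coeff_apply]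
    refine Finset.sum_congr rfl fun n _ => ?_
    have hs : (fun j => if m = j then (1 : ℂ) else 0) = Pi.single m 1 := by
      ext j; simp [Pi.single_apply, eq_comm]
    rw [hs]
    ring
  rw [h]
  exact Submodule.sum_mem _ fun p _ => Submodule.smul_mem _ _ (Submodule.subset_span ⟨p, rfl⟩)

/-- A nonzero `E` would contain a minimal invariant subspace inside the coefficients of one U_ℓ,
whose elements are then orthogonal to themselves. -/
theorem eq_bot_of_orthogonal_coeff (hU : IsCompleteIrrepList U) (E : Submodule ℂ C(K, ℂ))
    [FiniteDimensional ℂ E] (hinv : ∀ κ : K, ∀ φ ∈ E, rightTranslate κ φ ∈ E)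
    (horth : ∀ φ ∈ E, ∀ ℓ m n, inner ℂ (toL2 (coeff (U ℓ) m n)) (toL2 φ) = 0) : E = ⊥ := by
  by_contra hE
  obtain ⟨E₀, hle, hne, hinv₀, hmin⟩ := exists_minimal_invariant E hE hinv
  have : FiniteDimensional ℂ E₀ := Submodule.finiteDimensional_of_le hle
  obtain ⟨ℓ, hℓ⟩ := exists_mem_span_coeff hU E₀ hne hinv₀ hmin
  obtain ⟨φ, hφ, hφ0⟩ := Submodule.exists_mem_ne_zero_of_ne_bot hne
  have h : ∀ ψ ∈ Submodule.span ℂ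
      (Set.range fun p : Fin (d ℓ) × Fin (d ℓ) => coeff (U ℓ) p.1 p.2),
      inner ℂ (toL2 ψ) (toL2 φ) = 0 := by
    intro ψ hψ
    induction hψ using Submodule.span_induction with
    | mem _ h => obtain ⟨p, rfl⟩ := h; exact horth φ (hle hφ) _ _ _
    | zero => simp
    | add _ _ _ _ h₁ h₂ => rw [map_add, inner_add_left, h₁, h₂, add_zero]
    | smul c _ _ h => rw [map_smul, inner_smul_left, h, mul_zero]
  exact hφ0 (toL2_injective ((inner_self_eq_zero.1 (h φ (hℓ φ hφ))).trans (map_zero _).symm))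

end MatrixForm

/-! ### Convolution operators and the Peter–Weyl theorem -/

section Convolution

variable {K : Type*} [Group K] [TopologicalSpace K] [IsTopologicalGroup K] [CompactSpace K]
  [MeasurableSpace K] [BorelSpace K]

/-- The family `g ↦ (μ ↦ conj k(g μ⁻¹))` of elements of `L²(K)`. -/
noncomputable def kernelFamily (k : C(K, ℂ)) : C(K, Lp ℂ 2 (haarProb K)) :=
  (toL2 (K := K) : C(C(K, ℂ), Lp ℂ 2 (haarProb K))).comp
    (ContinuousMap.curry ⟨fun p : K × K => conj (k (p.1 * p.2⁻¹)), by fun_prop⟩)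

/-- The convolution operator `f ↦ (g ↦ ∫ k(g μ⁻¹) f(μ) dμ)` from `L²(K)` to `C(K)`. -/
noncomputable def convolution (k : C(K, ℂ)) : Lp ℂ 2 (haarProb K) →L[ℂ] C(K, ℂ) :=
  innerOperator (kernelFamily k)

theorem convolution_apply (k : C(K, ℂ)) (f : Lp ℂ 2 (haarProb K)) (g : K) :
    convolution k f g = ∫ μ, k (g * μ⁻¹) * f μ ∂(haarProb K) := by
  let c : C(K, ℂ) := ⟨fun μ => conj (k (g * μ⁻¹)), by fun_prop⟩
  change inner ℂ (toL2 c) f = _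
  rw [L2.inner_def]
  refine integral_congr_ae ?_
  filter_upwards [ContinuousMap.coeFn_toLp (p := 2) (𝕜 := ℂ) (haarProb K) c] with μ hμ
  rw [hμ, RCLike.inner_apply, mul_comm]
  simp [c]

theorem convolution_toL2_apply (k φ : C(K, ℂ)) (g : K) :
    convolution k (toL2 φ) g = ∫ μ, k (g * μ⁻¹) * φ μ ∂(haarProb K) := by
  rw [convolution_apply]
  refine integral_congr_ae ?_
  filter_upwards [ContinuousMap.coeFn_toLp (p := 2) (𝕜 := ℂ) (haarProb K) φ] with μ hμ
  rw [hμ]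

theorem convolution_rightTranslate (k φ : C(K, ℂ)) (κ : K) :
    convolution k (toL2 (rightTranslate κ φ)) = rightTranslate κ (convolution k (toL2 φ)) := by
  ext g
  rw [rightTranslate_apply, convolution_toL2_apply, convolution_toL2_apply,
    ← integral_mul_right_eq_self (fun μ => k (g * κ * μ⁻¹) * φ μ) κ]
  simp [mul_assoc]

/-- The convolution operator on `L²(K)`. -/
noncomputable def convolutionL2 (k : C(K, ℂ)) :
    Lp ℂ 2 (haarProb K) →L[ℂ] Lp ℂ 2 (haarProb K) :=
  toL2 ∘L convolution k

theorem isCompactOperator_convolutionL2 (k : C(K, ℂ)) : IsCompactOperator (convolutionL2 k) :=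
  (isCompactOperator_innerOperator (kernelFamily k)).clm_comp toL2

theorem integrable_coe (f : Lp ℂ 2 (haarProb K)) : Integrable f (haarProb K) :=
  (Lp.memLp f).integrable (by norm_num)

theorem integrable_conj {f : K → ℂ} (hf : Integrable f (haarProb K)) :
    Integrable (fun μ => conj (f μ)) (haarProb K) :=
  Complex.conjCLE.toContinuousLinearMap.integrable_comp hf

/-- Justifies Fubini both for convolutions and for L. Second countability makes the continuous
weight measurable for the product σ-algebra. -/
theorem integrable_kernel_mul [SecondCountableTopology K] {𝕜 : Type*} [RCLike 𝕜] {w : K × K → 𝕜}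
    (hw : Continuous w) {f h : K → 𝕜} (hf : Integrable f (haarProb K))
    (hh : Integrable h (haarProb K)) :
    Integrable (fun p : K × K => w p * (f p.1 * h p.2)) ((haarProb K).prod (haarProb K)) := by
  let c : C(K × K, 𝕜) := ⟨w, hw⟩
  exact (hf.mul_prod hh).bdd_mul (c := ‖c‖) hw.measurable.aestronglyMeasurable
    (Filter.Eventually.of_forall fun p => c.norm_coe_le_norm p)

theorem inner_convolutionL2_left (k : C(K, ℂ)) (f h : Lp ℂ 2 (haarProb K)) :
    inner ℂ (convolutionL2 k f) h = ∫ g, ∫ μ,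
      conj (k (g * μ⁻¹)) * (h g * conj (f μ)) ∂(haarProb K) ∂(haarProb K) := by
  rw [L2.inner_def]
  refine integral_congr_ae ?_
  filter_upwards [ContinuousMap.coeFn_toLp (p := 2) (𝕜 := ℂ) (haarProb K) (convolution k f)]
    with g hg
  change inner ℂ (toL2 (convolution k f) g) (h g) = _
  rw [hg, RCLike.inner_apply, convolution_apply, ← integral_conj, ← integral_const_mul]
  congr 1 with μ
  rw [map_mul]
  ring

theorem inner_convolutionL2_right (k : C(K, ℂ)) (f h : Lp ℂ 2 (haarProb K)) :
    inner ℂ f (convolutionL2 k h) = ∫ μ, ∫ g,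
      k (μ * g⁻¹) * (h g * conj (f μ)) ∂(haarProb K) ∂(haarProb K) := by
  rw [L2.inner_def]
  refine integral_congr_ae ?_
  filter_upwards [ContinuousMap.coeFn_toLp (p := 2) (𝕜 := ℂ) (haarProb K) (convolution k h)]
    with μ hμ
  change inner ℂ (f μ) (toL2 (convolution k h) μ) = _
  rw [hμ, RCLike.inner_apply, convolution_apply, ← integral_mul_const]
  congr 1 with g
  ring

theorem isSymmetric_convolutionL2 [SecondCountableTopology K] {k : C(K, ℂ)}
    (hk : ∀ g, k g⁻¹ = conj (k g)) : (convolutionL2 k).toLinearMap.IsSymmetric := by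
  intro f h
  change inner ℂ (convolutionL2 k f) h = inner ℂ f (convolutionL2 k h)
  have hk' : ∀ μ g, k (μ * g⁻¹) = conj (k (g * μ⁻¹)) := fun μ g => by
    rw [← hk, mul_inv_rev, inv_inv]
  rw [inner_convolutionL2_left, inner_convolutionL2_right]
  refine (integral_integral_swap ?_).trans ?_
  swap
  · congr 1 with μ
    congr 1 with g
    rw [hk' μ g]
  have hw : Continuous fun p : K × K => conj (k (p.1 * p.2⁻¹)) := by fun_prop
  exact integrable_kernel_mul hw (f := fun g => h g) (h := fun μ => conj (f μ))
    (integrable_coe h) (integrable_conj (integrable_coe f))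

variable {ι : Type*} {d : ι → ℕ}

/-- The span of the matrix coefficients in `L²(K)`. -/
noncomputable def coeffSpan (U : ∀ ℓ, K →ₜ* Matrix.unitaryGroup (Fin (d ℓ)) ℂ) :
    Submodule ℂ (Lp ℂ 2 (haarProb K)) :=
  Submodule.span ℂ (Set.range fun p : (ℓ : ι) × Fin (d ℓ) × Fin (d ℓ) =>
    toL2 (coeff (U p.1) p.2.1 p.2.2))

variable {U : ∀ ℓ, K →ₜ* Matrix.unitaryGroup (Fin (d ℓ)) ℂ}

theorem toL2_coeff_mem (ℓ : ι) (m n : Fin (d ℓ)) : toL2 (coeff (U ℓ) m n) ∈ coeffSpan U :=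
  Submodule.subset_span ⟨⟨ℓ, m, n⟩, rfl⟩

theorem mem_coeffSpan_orthogonal {f : Lp ℂ 2 (haarProb K)} :
    f ∈ (coeffSpan U)ᗮ ↔ ∀ ℓ m n, inner ℂ (toL2 (coeff (U ℓ) m n)) f = 0 := by
  refine ⟨fun h ℓ m n => h _ (toL2_coeff_mem ℓ m n), fun h g hg => ?_⟩
  induction hg using Submodule.span_induction with
  | mem _ hx => obtain ⟨p, rfl⟩ := hx; exact h _ _ _
  | zero => simp
  | add _ _ _ _ h₁ h₂ => rw [inner_add_left, h₁, h₂, add_zero]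
  | smul c _ _ h => rw [inner_smul_left, h, mul_zero]

theorem convolution_coeff (k : C(K, ℂ)) (ℓ : ι) (m n : Fin (d ℓ)) :
    convolution k (toL2 (coeff (U ℓ) m n)) = ∑ p, (∫ ν, k ν *
      (U ℓ ν⁻¹ : Matrix (Fin (d ℓ)) (Fin (d ℓ)) ℂ) m p ∂(haarProb K)) • coeff (U ℓ) p n := by
  ext g
  have hc : ∀ p, Continuous fun ν => k ν *
      (U ℓ ν⁻¹ : Matrix (Fin (d ℓ)) (Fin (d ℓ)) ℂ) m p := fun p =>
    k.continuous.mul ((continuous_entry (U ℓ) m p).comp continuous_inv)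
  rw [convolution_toL2_apply, ContinuousMap.sum_apply]
  simp only [ContinuousMap.smul_apply, coeff_apply, smul_eq_mul, ← integral_mul_const]
  rw [← integral_finsetSum _ fun p _ => integrable_of_continuous ((hc p).mul_const _)]
  -- Substitute ν = gμ⁻¹; then μ = ν⁻¹g and U(μ) factors as U(ν⁻¹)U(g).
  conv_rhs => rw [← integral_div_left_eq_self _ (haarProb K) g]
  congr 1 with μ
  rw [← div_eq_mul_inv]
  have h : (U ℓ μ : Matrix (Fin (d ℓ)) (Fin (d ℓ)) ℂ) m n = _ :=
    (congrArg (fun x => (U ℓ x : Matrix (Fin (d ℓ)) (Fin (d ℓ)) ℂ) m n)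
      (show μ = (g / μ)⁻¹ * g by simp)).trans (entry_mul (U ℓ) _ _ m n)
  rw [h, Finset.mul_sum]
  exact Finset.sum_congr rfl fun p _ => (mul_assoc _ _ _).symm

theorem convolutionL2_coeff_mem (k : C(K, ℂ)) (ℓ : ι) (m n : Fin (d ℓ)) :
    convolutionL2 k (toL2 (coeff (U ℓ) m n)) ∈ coeffSpan U := by
  change toL2 (convolution k _) ∈ _
  rw [convolution_coeff, map_sum]
  exact Submodule.sum_mem _ fun p _ => by
    rw [map_smul]; exact Submodule.smul_mem _ _ (toL2_coeff_mem ℓ p n)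

theorem convolutionL2_mem_orthogonal [SecondCountableTopology K] {k : C(K, ℂ)} (hk : ∀ g, k g⁻¹ = conj (k g)) :
    ∀ f ∈ (coeffSpan U)ᗮ, convolutionL2 k f ∈ (coeffSpan U)ᗮ := by
  intro f hf
  rw [mem_coeffSpan_orthogonal]
  intro ℓ m n
  refine (isSymmetric_convolutionL2 hk _ _).symm.trans ?_
  exact hf _ (convolutionL2_coeff_mem k ℓ m n)

/-- A convolution operator with hermitian kernel has no nonzero eigenvalue on the orthogonal
complement of the matrix coefficients. -/
theorem eq_zero_of_convolutionL2_eq_smul (hU : IsCompleteIrrepList U) {k : C(K, ℂ)} {c : ℂ}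
    (hc : c ≠ 0) {f : Lp ℂ 2 (haarProb K)} (hf : f ∈ (coeffSpan U)ᗮ)
    (hfc : convolutionL2 k f = c • f) : f = 0 := by
  -- The eigenspace is taken inside C(K): an eigenvector f = c⁻¹ k∗f has a continuous representative
  -- because c ≠ 0.
  let E : Submodule ℂ C(K, ℂ) :=
    (LinearMap.ker ((convolution k).toLinearMap ∘ₗ (toL2 (K := K)).toLinearMap -
      c • LinearMap.id)) ⊓ (coeffSpan U)ᗮ.comap (toL2 (K := K)).toLinearMap
  have hmem : ∀ φ, φ ∈ E ↔ convolution k (toL2 φ) = c • φ ∧ toL2 φ ∈ (coeffSpan U)ᗮ := by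
    intro φ
    simp [E, sub_eq_zero]
  have hfin : FiniteDimensional ℂ E := by
    have := ContinuousLinearMap.finite_dimensional_eigenspace
      (isCompactOperator_convolutionL2 k) c hc
    let j : E →ₗ[ℂ] Module.End.eigenspace (convolutionL2 k).toLinearMap c :=
      ((toL2 (K := K)).toLinearMap ∘ₗ E.subtype).codRestrict _ fun φ => by
        rw [Module.End.mem_eigenspace_iff]
        change toL2 (convolution k (toL2 (φ : C(K, ℂ)))) = c • toL2 (φ : C(K, ℂ))
        rw [((hmem φ).1 φ.2).1, map_smul]
    refine Module.Finite.of_injective j fun φ ψ h => ?_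
    exact Subtype.ext (toL2_injective (congrArg Subtype.val h))
  have hE : E = ⊥ := by
    refine eq_bot_of_orthogonal_coeff hU E (fun κ φ hφ => ?_) fun φ hφ =>
      mem_coeffSpan_orthogonal.1 ((hmem φ).1 hφ).2
    rw [hmem] at hφ ⊢
    refine ⟨by rw [convolution_rightTranslate, hφ.1, map_smul], ?_⟩
    rw [mem_coeffSpan_orthogonal]
    intro ℓ m n
    -- The translation is moved onto the coefficient, which stays in the span of the coefficients in
    -- its row.
    rw [← inner_toL2_rightTranslate κ⁻¹, ← rightTranslate_mul, inv_mul_cancel, rightTranslate_one]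
    have h : rightTranslate κ⁻¹ (coeff (U ℓ) m n) =
        ∑ p, (U ℓ κ⁻¹ : Matrix (Fin (d ℓ)) (Fin (d ℓ)) ℂ) p n • coeff (U ℓ) m p := by
      ext g
      simp only [rightTranslate_apply, coeff_apply, entry_mul, ContinuousMap.sum_apply,
        ContinuousMap.smul_apply, smul_eq_mul]
      exact Finset.sum_congr rfl fun _ _ => mul_comm _ _
    rw [h, map_sum, sum_inner]
    refine Finset.sum_eq_zero fun p _ => ?_
    rw [map_smul, inner_smul_left, mem_coeffSpan_orthogonal.1 hφ.2, mul_zero]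
  have hφ : toL2 (c⁻¹ • convolution k f) = f := by
    rw [map_smul]
    change c⁻¹ • convolutionL2 k f = f
    rw [hfc, inv_smul_smul₀ hc]
  have h0 : c⁻¹ • convolution k f ∈ E := by
    rw [hmem, hφ, smul_inv_smul₀ hc]
    exact ⟨rfl, hf⟩
  rw [hE, Submodule.mem_bot] at h0
  rw [← hφ, h0, map_zero]

/-- A compact symmetric operator whose only possible eigenvalue is 0 vanishes; this is applied to
the restriction to the complement. -/
theorem convolution_eq_zero_of_hermitian [SecondCountableTopology K] (hU : IsCompleteIrrepList U) {k : C(K, ℂ)}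
    (hk : ∀ g, k g⁻¹ = conj (k g)) {f : Lp ℂ 2 (haarProb K)} (hf : f ∈ (coeffSpan U)ᗮ) :
    convolution k f = 0 := by
  have hinv := convolutionL2_mem_orthogonal (U := U) hk
  let S : (coeffSpan U)ᗮ →L[ℂ] (coeffSpan U)ᗮ := (convolutionL2 k).restrict hinv
  have hS : IsCompactOperator S := (isCompactOperator_convolutionL2 k).restrict' hinv
  have hS' : S.IsSymmetric := (isSymmetric_convolutionL2 hk).restrict_invariant hinv
  have h0 : S = 0 := by
    refine (ContinuousLinearMap.eq_zero_of_forall_hasEigenvalue_eq_zero hS hS').1 fun c hc => ?_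
    by_contra hne
    obtain ⟨g, hg⟩ := hc.exists_hasEigenvector
    refine hg.2 (Subtype.ext ?_)
    exact eq_zero_of_convolutionL2_eq_smul hU hne g.2 (congrArg Subtype.val hg.apply_eq_smul)
  apply toL2_injective
  have h1 := congrArg (fun A : (coeffSpan U)ᗮ →L[ℂ] (coeffSpan U)ᗮ => (A ⟨f, hf⟩).1) h0
  exact h1.trans (map_zero _).symm

theorem convolution_eq_zero [SecondCountableTopology K] (hU : IsCompleteIrrepList U) (k : C(K, ℂ))
    {f : Lp ℂ 2 (haarProb K)} (hf : f ∈ (coeffSpan U)ᗮ) : convolution k f = 0 := by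
  -- Hermitian kernels with 2k = a - i b.
  let a : C(K, ℂ) := ⟨fun g => k g + conj (k g⁻¹), by fun_prop⟩
  let b : C(K, ℂ) := ⟨fun g => Complex.I * (k g - conj (k g⁻¹)), by fun_prop⟩
  have ha : convolution a f = 0 :=
    convolution_eq_zero_of_hermitian hU (fun g => by simp [a, add_comm]) hf
  have hb : convolution b f = 0 :=
    convolution_eq_zero_of_hermitian hU (fun g => by simp [b]; ring) hf
  have hint : ∀ (c : C(K, ℂ)) (g : K), Integrable (fun μ => c (g * μ⁻¹) * f μ) (haarProb K) := by
    intro c g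
    let c' : C(K, ℂ) := ⟨fun μ => c (g * μ⁻¹), by fun_prop⟩
    exact (integrable_coe f).bdd_mul (c := ‖c'‖) c'.continuous.measurable.aestronglyMeasurable
      (Filter.Eventually.of_forall fun μ => c'.norm_coe_le_norm μ)
  ext g
  have h : (2 : ℂ) * convolution k f g = convolution a f g - Complex.I * convolution b f g := by
    simp only [convolution_apply, ← integral_const_mul]
    rw [← integral_sub (hint a g) ((hint b g).const_mul _)]
    congr 1 with μ
    simp only [a, b, ContinuousMap.coe_mk]
    linear_combination ((k (g * μ⁻¹) - conj (k (g * μ⁻¹)⁻¹)) * f μ) * Complex.I_mul_I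
  rw [ha, hb] at h
  simpa using h

/-- **Peter–Weyl theorem**: the matrix coefficients of the irreducible representations have dense
span in `L²(K)`. -/
theorem coeffSpan_orthogonal_eq_bot [SecondCountableTopology K] [T2Space K] (hU : IsCompleteIrrepList U) :
    (coeffSpan U)ᗮ = ⊥ := by
  rw [Submodule.eq_bot_iff]
  intro f hf
  refine Dense.eq_zero_of_inner_right (𝕜 := ℂ)
    (ContinuousMap.toLp_denseRange ℂ (haarProb K) ℂ (p := 2) (by norm_num)) ?_
  rintro _ ⟨φ, rfl⟩
  -- Chosen so that the convolution evaluated at 1 is ⟨φ, f⟩.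
  let k : C(K, ℂ) := ⟨fun μ => conj (φ μ⁻¹), by fun_prop⟩
  have h := congrArg (fun ψ : C(K, ℂ) => ψ 1) (convolution_eq_zero hU k hf)
  simp only [convolution_apply, ContinuousMap.zero_apply] at h
  change inner ℂ (toL2 φ) f = 0
  rw [← h, L2.inner_def]
  refine integral_congr_ae ?_
  filter_upwards [ContinuousMap.coeFn_toLp (p := 2) (𝕜 := ℂ) (haarProb K) φ] with μ hμ
  rw [hμ, RCLike.inner_apply]
  simp [k, mul_comm]

end Convolution

/-! ### Invariance and symmetry of the affinity -/

section AffinityLemmas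

variable {K : Type*} [Group K] {V : Type*} [NormedAddCommGroup V] [MulAction K V] {N : ℕ}

theorem affinity_mul_mul [IsIsometricSMul K V] (ε : ℝ) (x : Fin N → V) (i j : Fin N) (g κ μ : K) :
    affinity ε x i j (g * κ) (g * μ) = affinity ε x i j κ μ := by
  unfold affinity
  rw [mul_smul, mul_smul, ← dist_eq_norm, ← dist_eq_norm, dist_smul]

theorem affinity_swap (ε : ℝ) (x : Fin N → V) (i j : Fin N) (κ μ : K) :
    affinity ε x i j κ μ = affinity ε x j i μ κ := by
  unfold affinity
  rw [norm_sub_rev]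

theorem affinity_nonneg (ε : ℝ) (x : Fin N → V) (i j : Fin N) (κ μ : K) :
    0 ≤ affinity ε x i j κ μ := (Real.exp_pos _).le

theorem continuous_affinity_one [TopologicalSpace K] [ContinuousSMul K V] (ε : ℝ) (x : Fin N → V)
    (i j : Fin N) : Continuous fun μ : K => affinity ε x i j 1 μ :=
  (continuous_affinity ε x i j).comp (Continuous.prodMk_right 1)

theorem integral_affinity [TopologicalSpace K] [IsTopologicalGroup K] [CompactSpace K]
    [MeasurableSpace K] [BorelSpace K] [IsIsometricSMul K V] (ε : ℝ) (x : Fin N → V)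
    (i j : Fin N) (κ : K) :
    ∫ μ, affinity ε x i j κ μ ∂(haarProb K) = ∫ μ, affinity ε x i j 1 μ ∂(haarProb K) := by
  rw [← integral_mul_left_eq_self _ κ]
  congr 1 with μ
  simpa using affinity_mul_mul ε x i j κ 1 μ

end AffinityLemmas

/-! ### Integrals and inner products slice by slice -/

section GammaIntegrals

variable {K : Type*} [Group K] [TopologicalSpace K] [IsTopologicalGroup K] [CompactSpace K]
  [MeasurableSpace K] [BorelSpace K] {N : ℕ}

theorem integral_gammaMeasure {f : Fin N × K → ℂ} (hf : Integrable f (gammaMeasure K N)) :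
    ∫ p, f p ∂(gammaMeasure K N) = ∑ i, ∫ κ, f (i, κ) ∂(haarProb K) := by
  unfold gammaMeasure at hf ⊢
  rw [integral_prod _ hf, integral_count]

theorem GammaL2.integrable_mul_conj_slice (f h : GammaL2 K N) (i : Fin N) :
    Integrable (fun κ => h (i, κ) * conj (f (i, κ))) (haarProb K) :=
  InvariantGraphLaplacian.integrable_slice (L2.integrable_inner (𝕜 := ℂ) f h) i

theorem GammaL2.inner_eq_sum (f h : GammaL2 K N) :
    inner ℂ f h = ∑ i, ∫ κ, h (i, κ) * conj (f (i, κ)) ∂(haarProb K) := by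
  rw [L2.inner_def, integral_gammaMeasure (L2.integrable_inner (𝕜 := ℂ) f h)]
  rfl

theorem GammaL2.integrable_norm_sq_slice (f : GammaL2 K N) (i : Fin N) :
    Integrable (fun κ => ‖f (i, κ)‖ ^ 2) (haarProb K) := by
  refine (f.integrable_mul_conj_slice f i).norm.congr (Filter.Eventually.of_forall fun κ => ?_)
  simp [sq]

theorem GammaL2.memLp_slice (f : GammaL2 K N) (i : Fin N) :
    MemLp (fun κ => f (i, κ)) 2 (haarProb K) :=
  (memLp_two_iff_integrable_sq_norm (f.integrable_slice i).aestronglyMeasurable).2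
    (f.integrable_norm_sq_slice i)

theorem GammaL2.inner_toLp_eq_sum {φ : Fin N × K → ℂ} (hφ : MemLp φ 2 (gammaMeasure K N))
    (h : GammaL2 K N) :
    inner ℂ (hφ.toLp φ) h = ∑ i, ∫ κ, h (i, κ) * conj (φ (i, κ)) ∂(haarProb K) := by
  rw [GammaL2.inner_eq_sum]
  refine Finset.sum_congr rfl fun i _ => integral_congr_ae ?_
  filter_upwards [ae_slice hφ.coeFn_toLp i] with κ hκ
  rw [hκ]

end GammaIntegrals

/-! ### Self-adjointness and positivity of the Laplacian -/

section Positivity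

variable {K : Type*} [Group K] [TopologicalSpace K] [IsTopologicalGroup K] [CompactSpace K]
  [MeasurableSpace K] [BorelSpace K]
  {V : Type*} [NormedAddCommGroup V] [MulAction K V] [ContinuousSMul K V] {N : ℕ}

theorem GammaL2.inner_laplacian (ε : ℝ) (x : Fin N → V) (f h : GammaL2 K N) :
    inner ℂ f (laplacian K ε x h) =
      ∑ i, ((degree K ε x i : ℂ) * ∫ κ, h (i, κ) * conj (f (i, κ)) ∂(haarProb K) -
        ∑ j, ∫ κ, ∫ μ, (affinity ε x i j κ μ : ℂ) * (conj (f (i, κ)) * h (j, μ))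
          ∂(haarProb K) ∂(haarProb K)) := by
  rw [GammaL2.inner_eq_sum]
  refine Finset.sum_congr rfl fun i _ => ?_
  have hf : Integrable (fun κ => conj (f (i, κ))) (haarProb K) :=
    integrable_conj (f.integrable_slice i)
  have hint : ∀ j, Integrable (fun κ => conj (f (i, κ)) *
      ∫ μ, (affinity ε x i j κ μ : ℂ) * h (j, μ) ∂(haarProb K)) (haarProb K) := by
    intro j
    let c : C(K, ℂ) := ⟨fun κ => ∫ μ, (affinity ε x i j κ μ : ℂ) * h (j, μ) ∂(haarProb K),
      continuous_integral_mul (continuous_affinity ε x i j) (h.integrable_slice j)⟩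
    exact hf.mul_bdd (c := ‖c‖) c.continuous.measurable.aestronglyMeasurable
      (Filter.Eventually.of_forall fun κ => c.norm_coe_le_norm κ)
  rw [← integral_const_mul]
  have hj : ∀ j, ∫ κ, ∫ μ, (affinity ε x i j κ μ : ℂ) * (conj (f (i, κ)) * h (j, μ))
      ∂(haarProb K) ∂(haarProb K) = ∫ κ, conj (f (i, κ)) *
      ∫ μ, (affinity ε x i j κ μ : ℂ) * h (j, μ) ∂(haarProb K) ∂(haarProb K) := by
    intro j
    congr 1 with κ
    rw [← integral_const_mul]
    congr 1 with μ
    ring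
  simp only [hj]
  rw [← integral_finsetSum _ fun j _ => hint j, ← integral_sub
    ((f.integrable_mul_conj_slice h i).const_mul _) (integrable_finsetSum _ fun j _ => hint j)]
  refine integral_congr_ae ?_
  filter_upwards [ae_slice (laplacian_coe ε x h) i] with κ hκ
  rw [hκ]
  simp only [laplacianFun, affinityFun, sub_mul, Finset.sum_mul, mul_assoc]
  congr 1
  exact Finset.sum_congr rfl fun j _ => mul_comm _ _

variable [SecondCountableTopology K]

theorem integrable_affinity_mul_mul (ε : ℝ) (x : Fin N → V) (f h : GammaL2 K N) (i j : Fin N) :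
    Integrable (fun p : K × K => (affinity ε x i j p.1 p.2 : ℂ) * (conj (f (i, p.1)) * h (j, p.2)))
      ((haarProb K).prod (haarProb K)) := by
  have hw : Continuous fun p : K × K => (affinity ε x i j p.1 p.2 : ℂ) :=
    Complex.continuous_ofReal.comp (continuous_affinity ε x i j)
  exact integrable_kernel_mul hw (f := fun κ => conj (f (i, κ))) (h := fun μ => h (j, μ))
    (integrable_conj (f.integrable_slice i)) (h.integrable_slice j)

/-- The degrees are real and the kernel is real and symmetric under exchanging (i, κ) with (j, μ);
Fubini swaps the integrals. -/
theorem isSymmetric_laplacian (ε : ℝ) (x : Fin N → V) : (laplacian K ε x).IsSymmetric := by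
  intro f h
  rw [← inner_conj_symm, GammaL2.inner_laplacian, GammaL2.inner_laplacian]
  simp only [Finset.sum_sub_distrib, map_sub, map_sum]
  congr 1
  · refine Finset.sum_congr rfl fun i _ => ?_
    rw [map_mul, Complex.conj_ofReal, ← integral_conj]
    congr 2 with κ
    rw [map_mul, Complex.conj_conj, mul_comm]
  · rw [Finset.sum_comm]
    refine Finset.sum_congr rfl fun i _ => Finset.sum_congr rfl fun j _ => ?_
    rw [integral_integral_swap (integrable_affinity_mul_mul ε x h f j i), ← integral_conj]
    congr 1 with μ
    rw [← integral_conj]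
    congr 1 with κ
    rw [affinity_swap]
    simp only [map_mul, Complex.conj_ofReal, Complex.conj_conj]
    ring

variable [IsIsometricSMul K V]

theorem norm_integral_affinity_le (ε : ℝ) (x : Fin N → V) (f : GammaL2 K N) (i j : Fin N) :
    ‖∫ κ, ∫ μ, (affinity ε x i j κ μ : ℂ) * (conj (f (i, κ)) * f (j, μ))
        ∂(haarProb K) ∂(haarProb K)‖ ≤
      ((∫ μ, affinity ε x i j (1 : K) μ ∂(haarProb K)) * ∫ κ, ‖f (i, κ)‖ ^ 2 ∂(haarProb K) +
       (∫ μ, affinity ε x j i (1 : K) μ ∂(haarProb K)) * ∫ κ, ‖f (j, κ)‖ ^ 2 ∂(haarProb K)) / 2 := by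
  have hc := continuous_affinity (K := K) ε x i j
  have h1 : Integrable (fun p : K × K => affinity ε x i j p.1 p.2 * (‖f (i, p.1)‖ ^ 2 * 1))
      ((haarProb K).prod (haarProb K)) :=
    integrable_kernel_mul hc (f.integrable_norm_sq_slice i) (integrable_const 1)
  have h2 : Integrable (fun p : K × K => affinity ε x i j p.1 p.2 * (1 * ‖f (j, p.2)‖ ^ 2))
      ((haarProb K).prod (haarProb K)) :=
    integrable_kernel_mul hc (integrable_const 1) (f.integrable_norm_sq_slice j)
  have e1 : ∫ p : K × K, affinity ε x i j p.1 p.2 * (‖f (i, p.1)‖ ^ 2 * 1)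
      ∂((haarProb K).prod (haarProb K)) =
      (∫ μ, affinity ε x i j (1 : K) μ ∂(haarProb K)) * ∫ κ, ‖f (i, κ)‖ ^ 2 ∂(haarProb K) := by
    rw [integral_prod _ h1, ← integral_const_mul]
    congr 1 with κ
    simp only [integral_mul_const, integral_affinity, mul_one]
  have e2 : ∫ p : K × K, affinity ε x i j p.1 p.2 * (1 * ‖f (j, p.2)‖ ^ 2)
      ∂((haarProb K).prod (haarProb K)) =
      (∫ μ, affinity ε x j i (1 : K) μ ∂(haarProb K)) * ∫ κ, ‖f (j, κ)‖ ^ 2 ∂(haarProb K) := by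
    rw [integral_prod_symm _ h2, ← integral_const_mul]
    congr 1 with κ
    simp only [affinity_swap ε x i j]
    rw [integral_mul_const, integral_affinity, one_mul]
  rw [integral_integral (integrable_affinity_mul_mul ε x f f i j), ← e1, ← e2,
    ← integral_add h1 h2, ← integral_div]
  refine norm_integral_le_of_norm_le ((h1.add h2).div_const 2)
    (Filter.Eventually.of_forall fun p => ?_)
  have hw := affinity_nonneg ε x i j p.1 p.2
  simp only [norm_mul, Complex.norm_real, Real.norm_eq_abs, abs_of_nonneg hw, RCLike.norm_conj]
  -- The weighted inequality 2ab ≤ a² + b².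
  nlinarith [mul_nonneg hw (sq_nonneg (‖f (i, p.1)‖ - ‖f (j, p.2)‖))]

theorem isPositive_laplacian (ε : ℝ) (x : Fin N → V) : (laplacian K ε x).IsPositive := by
  refine ⟨isSymmetric_laplacian ε x, fun f => ?_⟩
  rw [isSymmetric_laplacian ε x, GammaL2.inner_laplacian]
  have ha : ∀ i, ∫ κ, f (i, κ) * conj (f (i, κ)) ∂(haarProb K) =
      ((∫ κ, ‖f (i, κ)‖ ^ 2 ∂(haarProb K) : ℝ) : ℂ) := by
    intro i
    rw [← integral_complex_ofReal]
    congr 1 with κ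
    rw [Complex.mul_conj']
    norm_cast
  simp only [ha, Finset.sum_sub_distrib, map_sub, map_sum]
  rw [sub_nonneg]
  set A : Fin N → ℝ := fun i => ∫ κ, ‖f (i, κ)‖ ^ 2 ∂(haarProb K) with hA
  set c : Fin N → Fin N → ℝ := fun i j => ∫ μ, affinity ε x i j (1 : K) μ ∂(haarProb K) with hc
  -- After relabelling, the two halves have equal sums and together give exactly the degree term.
  calc _ ≤ ∑ i, ∑ j, (c i j * A i + c j i * A j) / 2 := by
        refine Finset.sum_le_sum fun i _ => Finset.sum_le_sum fun j _ => ?_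
        exact (RCLike.re_le_norm _).trans (norm_integral_affinity_le ε x f i j)
    _ = ∑ i, ∑ j, c i j * A i := by
        have h : ∑ i, ∑ j, c j i * A j = ∑ i, ∑ j, c i j * A i := Finset.sum_comm
        simp only [← Finset.sum_div, Finset.sum_add_distrib, h]
        ring
    _ = _ := by
        refine Finset.sum_congr rfl fun i _ => ?_
        rw [← Finset.sum_mul]
        have h : RCLike.re ((degree K ε x i : ℂ) * (A i : ℂ)) = degree K ε x i * A i := by
          rw [← Complex.ofReal_mul]
          exact Complex.ofReal_re _
        exact h.symm

end Positivity

/-! ### Orthogonality of the functions Φ -/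

section EigenFunctions

variable {K : Type*} [Group K] [TopologicalSpace K] [IsTopologicalGroup K] [CompactSpace K]
  [MeasurableSpace K] [BorelSpace K] {N d e : ℕ}

/-- The map `v ↦ Φ_m` as a linear map. -/
noncomputable def eigenLpLinear (U : K →ₜ* Matrix.unitaryGroup (Fin d) ℂ) (m : Fin d) :
    EuclideanSpace ℂ (Fin N × Fin d) →ₗ[ℂ] GammaL2 K N where
  toFun v := eigenLp U v m
  map_add' v w := by
    unfold eigenLp
    rw [← MemLp.toLp_add]
    refine MemLp.toLp_congr _ _ (Filter.Eventually.of_forall fun p => ?_)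
    simp [eigenFun, mul_add, Finset.sum_add_distrib]
  map_smul' c v := by
    unfold eigenLp
    rw [RingHom.id_apply, ← MemLp.toLp_const_smul]
    refine MemLp.toLp_congr _ _ (Filter.Eventually.of_forall fun p => ?_)
    simp only [eigenFun, PiLp.smul_apply, Pi.smul_apply, smul_eq_mul, Finset.mul_sum]
    exact Finset.sum_congr rfl fun n _ => by ring

@[simp]
theorem eigenLpLinear_apply (U : K →ₜ* Matrix.unitaryGroup (Fin d) ℂ) (m : Fin d)
    (v : EuclideanSpace ℂ (Fin N × Fin d)) : eigenLpLinear U m v = eigenLp U v m := rfl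

theorem inner_eigenLp (U : K →ₜ* Matrix.unitaryGroup (Fin d) ℂ)
    (U' : K →ₜ* Matrix.unitaryGroup (Fin e) ℂ) (v : EuclideanSpace ℂ (Fin N × Fin d))
    (w : EuclideanSpace ℂ (Fin N × Fin e)) (m : Fin d) (m' : Fin e) :
    inner ℂ (eigenLp U v m) (eigenLp U' w m') =
      ∑ i, ∑ n', ∑ n, w (i, n') * conj (v (i, n)) *
        ∫ κ, (U' κ : Matrix (Fin e) (Fin e) ℂ) m' n' *
          conj ((U κ : Matrix (Fin d) (Fin d) ℂ) m n) ∂(haarProb K) := by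
  unfold eigenLp
  rw [GammaL2.inner_toLp_eq_sum]
  refine Finset.sum_congr rfl fun i _ => ?_
  have hint : ∀ n' n, Integrable (fun κ => w (i, n') * conj (v (i, n)) *
      ((U' κ : Matrix (Fin e) (Fin e) ℂ) m' n' *
        conj ((U κ : Matrix (Fin d) (Fin d) ℂ) m n))) (haarProb K) := fun n' n =>
    integrable_of_continuous (continuous_const.mul
      ((continuous_entry U' m' n').mul (Complex.continuous_conj.comp (continuous_entry U m n))))
  simp only [← integral_const_mul]
  have hs : ∀ n', ∑ n, ∫ κ, w (i, n') * conj (v (i, n)) *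
      ((U' κ : Matrix (Fin e) (Fin e) ℂ) m' n' *
        conj ((U κ : Matrix (Fin d) (Fin d) ℂ) m n)) ∂(haarProb K) =
      ∫ κ, ∑ n, w (i, n') * conj (v (i, n)) *
      ((U' κ : Matrix (Fin e) (Fin e) ℂ) m' n' *
        conj ((U κ : Matrix (Fin d) (Fin d) ℂ) m n)) ∂(haarProb K) := fun n' =>
    (integral_finsetSum _ fun n _ => hint n' n).symm
  simp only [hs]
  rw [← integral_finsetSum _ fun n' _ => integrable_finsetSum _ fun n _ => hint n' n]
  refine integral_congr_ae ?_
  filter_upwards [ae_slice (memLp_of_continuous (continuous_eigenFun U' w m')).coeFn_toLp i]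
    with κ hκ
  rw [hκ]
  simp only [eigenFun, map_sum, map_mul]
  rw [Finset.sum_mul_sum]
  exact Finset.sum_congr rfl fun n' _ => Finset.sum_congr rfl fun n _ => by ring

theorem inner_eigenLp_of_isEmpty_equiv (U : K →ₜ* Matrix.unitaryGroup (Fin d) ℂ)
    (U' : K →ₜ* Matrix.unitaryGroup (Fin e) ℂ) (hU : (matrixRep U).IsIrreducible)
    (hU' : (matrixRep U').IsIrreducible) (h : IsEmpty ((matrixRep U).Equiv (matrixRep U')))
    (v : EuclideanSpace ℂ (Fin N × Fin d)) (w : EuclideanSpace ℂ (Fin N × Fin e))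
    (m : Fin d) (m' : Fin e) : inner ℂ (eigenLp U v m) (eigenLp U' w m') = 0 := by
  simp only [inner_eigenLp, integral_entry_mul_conj_eq_zero U' U hU' hU h, mul_zero,
    Finset.sum_const_zero]

theorem inner_eigenLp_self (U : K →ₜ* Matrix.unitaryGroup (Fin d) ℂ)
    (hU : (matrixRep U).IsIrreducible) (v w : EuclideanSpace ℂ (Fin N × Fin d)) (m m' : Fin d) :
    inner ℂ (eigenLp U v m) (eigenLp U w m') =
      if m = m' then (d : ℂ)⁻¹ * inner ℂ v w else 0 := by
  simp only [inner_eigenLp, integral_entry_mul_conj_self U hU]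
  by_cases h : m = m'
  · simp only [h, true_and, if_true, mul_ite, mul_zero, Finset.sum_ite_eq, Finset.mem_univ,
      PiLp.inner_apply, RCLike.inner_apply, Finset.mul_sum]
    rw [Fintype.sum_prod_type]
    exact Finset.sum_congr rfl fun i _ => Finset.sum_congr rfl fun n _ => mul_comm _ _
  · have h' : ¬m' = m := fun h' => h h'.symm
    simp [h, h']

theorem eigenLp_ne_zero (U : K →ₜ* Matrix.unitaryGroup (Fin d) ℂ)
    (hU : (matrixRep U).IsIrreducible) {v : EuclideanSpace ℂ (Fin N × Fin d)} (hv : v ≠ 0)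
    (m : Fin d) : eigenLp U v m ≠ 0 := by
  intro h
  have h1 := inner_eigenLp_self U hU v v m m
  rw [h, inner_zero_left, if_pos rfl, eq_comm, mul_eq_zero, inv_eq_zero] at h1
  exact h1.elim (fun hd => m.pos.ne' (by exact_mod_cast hd)) fun hv' => hv (inner_self_eq_zero.1 hv')

variable {ι : Type*} {d : ι → ℕ} {U : ∀ ℓ, K →ₜ* Matrix.unitaryGroup (Fin (d ℓ)) ℂ}

theorem pairwise_inner_eigenLp (hU : IsCompleteIrrepList U)
    {v : ∀ ℓ, Fin (N * d ℓ) → EuclideanSpace ℂ (Fin N × Fin (d ℓ))}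
    (hv : ∀ ℓ, Orthonormal ℂ (v ℓ)) :
    Pairwise fun a b : (ℓ : ι) × Fin (N * d ℓ) × Fin (d ℓ) =>
      inner ℂ (eigenLp (U a.1) (v a.1 a.2.1) a.2.2) (eigenLp (U b.1) (v b.1 b.2.1) b.2.2) = 0 := by
  rintro ⟨ℓ, s, m⟩ ⟨ℓ', s', m'⟩ hne
  by_cases hℓ : ℓ = ℓ'
  · subst hℓ
    dsimp only
    rw [inner_eigenLp_self _ (hU.irreducible ℓ)]
    by_cases hm : m = m'
    · have hs : s ≠ s' := fun hs => hne (by rw [hs, hm])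
      rw [if_pos hm, (hv ℓ).2 hs, mul_zero]
    · rw [if_neg hm]
  · refine inner_eigenLp_of_isEmpty_equiv _ _ (hU.irreducible ℓ) (hU.irreducible ℓ') ⟨fun F => ?_⟩
      _ _ _ _
    -- The uniqueness clause is applied to U_ℓ itself, which would be equivalent to two members of
    -- the list.
    exact hℓ ((hU.existsUnique _ (U ℓ) (hU.irreducible ℓ)).unique ⟨.refl _⟩ ⟨F⟩)

end EigenFunctions

/-! ### The symbol matrix and its action on the functions Φ -/

section Symbol

variable {K : Type*} [Group K] [TopologicalSpace K] [IsTopologicalGroup K] [CompactSpace K]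
  [MeasurableSpace K] [BorelSpace K]
  {V : Type*} [NormedAddCommGroup V] [MulAction K V] [IsIsometricSMul K V] {N d : ℕ}

/-- Inversion κ ↦ κ⁻¹ preserves Haar measure, conjugate-transposes U(κ), and satisfies W_ji(1, κ⁻¹)
= W_ij(1, κ). -/
theorem isHermitian_symbolMatrix (ε : ℝ) (x : Fin N → V)
    (U : K →ₜ* Matrix.unitaryGroup (Fin d) ℂ) : (symbolMatrix ε x U).IsHermitian := by
  refine Matrix.IsHermitian.sub ?_ ?_
  · ext p q
    simp only [Matrix.conjTranspose_apply, Matrix.kroneckerMap_apply, Matrix.diagonal_apply,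
      Matrix.one_apply, star_mul', RCLike.star_def]
    by_cases h1 : p.1 = q.1 <;> by_cases h2 : p.2 = q.2 <;>
      simp [h1, h2, eq_comm]
  · ext p q
    simp only [Matrix.conjTranspose_apply, fourierMatrix, Matrix.of_apply, RCLike.star_def]
    rw [← integral_conj, ← integral_inv_eq_self]
    congr 1 with κ
    have h : affinity ε x q.1 p.1 1 κ⁻¹ = affinity ε x p.1 q.1 1 κ := by
      rw [affinity_swap, ← affinity_mul_mul ε x p.1 q.1 κ]
      simp
    rw [map_mul, Complex.conj_ofReal, entry_inv, Complex.conj_conj, h]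

variable [ContinuousSMul K V]

/-- The block diagonalization of W: put μ = κν, use W_ij(κ, κν) = W_ij(1, ν), and split U(κν) =
U(κ)U(ν). -/
theorem affinityFun_eigenFun (ε : ℝ) (x : Fin N → V) (U : K →ₜ* Matrix.unitaryGroup (Fin d) ℂ)
    (v : EuclideanSpace ℂ (Fin N × Fin d)) (m : Fin d) (p : Fin N × K) :
    affinityFun ε x (eigenFun U v m) p =
      ∑ n, (U p.2 : Matrix (Fin d) (Fin d) ℂ) m n * (fourierMatrix ε x U *ᵥ v.ofLp) (p.1, n) := by
  have hint : ∀ j n l, Integrable (fun ν => (U p.2 : Matrix (Fin d) (Fin d) ℂ) m l *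
      (((affinity ε x p.1 j 1 ν : ℂ) * (U ν : Matrix (Fin d) (Fin d) ℂ) l n) * v (j, n)))
      (haarProb K) := fun j n l =>
    integrable_of_continuous (continuous_const.mul
      (((Complex.continuous_ofReal.comp (continuous_affinity_one ε x p.1 j)).mul
        (continuous_entry U l n)).mul continuous_const))
  have hj : ∀ j, ∫ μ, (affinity ε x p.1 j p.2 μ : ℂ) * eigenFun U v m (j, μ) ∂(haarProb K) =
      ∑ l, ∑ n, ∫ ν, (U p.2 : Matrix (Fin d) (Fin d) ℂ) m l *
      (((affinity ε x p.1 j 1 ν : ℂ) * (U ν : Matrix (Fin d) (Fin d) ℂ) l n) * v (j, n))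
      ∂(haarProb K) := by
    intro j
    have hs : ∀ l, ∑ n, ∫ ν, (U p.2 : Matrix (Fin d) (Fin d) ℂ) m l *
        (((affinity ε x p.1 j 1 ν : ℂ) * (U ν : Matrix (Fin d) (Fin d) ℂ) l n) * v (j, n))
        ∂(haarProb K) = ∫ ν, ∑ n, (U p.2 : Matrix (Fin d) (Fin d) ℂ) m l *
        (((affinity ε x p.1 j 1 ν : ℂ) * (U ν : Matrix (Fin d) (Fin d) ℂ) l n) * v (j, n))
        ∂(haarProb K) := fun l => (integral_finsetSum _ fun n _ => hint j n l).symm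
    simp only [hs]
    rw [← integral_finsetSum _ fun l _ => integrable_finsetSum _ fun n _ => hint j n l,
      ← integral_mul_left_eq_self _ p.2]
    congr 1 with ν
    have h : affinity ε x p.1 j p.2 (p.2 * ν) = affinity ε x p.1 j 1 ν := by
      simpa using affinity_mul_mul ε x p.1 j p.2 1 ν
    simp only [h, eigenFun, entry_mul, Finset.sum_mul, Finset.mul_sum]
    rw [Finset.sum_comm]
    exact Finset.sum_congr rfl fun _ _ => Finset.sum_congr rfl fun _ _ => by ring
  simp only [affinityFun, hj, integral_const_mul, integral_mul_const]
  rw [Finset.sum_comm]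
  refine Finset.sum_congr rfl fun l _ => ?_
  simp only [Matrix.mulVec, dotProduct, Fintype.sum_prod_type, Finset.mul_sum, fourierMatrix,
    Matrix.of_apply]

theorem laplacianFun_eigenFun (ε : ℝ) (x : Fin N → V) (U : K →ₜ* Matrix.unitaryGroup (Fin d) ℂ)
    (v : EuclideanSpace ℂ (Fin N × Fin d)) (m : Fin d) :
    laplacianFun ε x (eigenFun U v m) =
      eigenFun U (WithLp.toLp 2 (symbolMatrix ε x U *ᵥ v.ofLp)) m := by
  ext p
  have hD : ∀ n, ((Matrix.diagonal (fun i => (degree K ε x i : ℂ)) ⊗ₖ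
      (1 : Matrix (Fin d) (Fin d) ℂ)) *ᵥ v.ofLp) (p.1, n) = degree K ε x p.1 * v (p.1, n) := by
    intro n
    rw [← Matrix.diagonal_one, Matrix.diagonal_kronecker_diagonal, Matrix.mulVec_diagonal]
    simp
  simp only [laplacianFun, affinityFun_eigenFun]
  simp only [eigenFun, symbolMatrix, Matrix.sub_mulVec, Pi.sub_apply, mul_sub,
    Finset.sum_sub_distrib, hD, Finset.mul_sum]
  congr 1
  exact Finset.sum_congr rfl fun n _ => by ring

theorem laplacian_eigenLp (ε : ℝ) (x : Fin N → V) (U : K →ₜ* Matrix.unitaryGroup (Fin d) ℂ)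
    (v : EuclideanSpace ℂ (Fin N × Fin d)) (m : Fin d) :
    laplacian K ε x (eigenLp U v m) =
      eigenLp U (WithLp.toLp 2 (symbolMatrix ε x U *ᵥ v.ofLp)) m := by
  refine MemLp.toLp_congr (memLp_laplacianFun ε x _) (memLp_of_continuous
    (continuous_eigenFun U _ m)) ?_
  have hae := (memLp_of_continuous (continuous_eigenFun U v m)).coeFn_toLp
  filter_upwards [hae] with p hp
  rw [← laplacianFun_eigenFun]
  simp only [laplacianFun, affinityFun]
  congr 1
  · rw [← hp]; rfl
  · refine Finset.sum_congr rfl fun j _ => integral_congr_ae ?_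
    filter_upwards [ae_slice hae j] with μ hμ
    rw [← hμ]; rfl

theorem laplacian_eigenLp_of_eigen (ε : ℝ) (x : Fin N → V)
    (U : K →ₜ* Matrix.unitaryGroup (Fin d) ℂ) {v : EuclideanSpace ℂ (Fin N × Fin d)} {z : ℂ}
    (hv : symbolMatrix ε x U *ᵥ v.ofLp = z • v.ofLp) (m : Fin d) :
    laplacian K ε x (eigenLp U v m) = z • eigenLp U v m := by
  rw [laplacian_eigenLp, hv]
  exact (eigenLpLinear U m).map_smul z v

theorem exists_isEigenSystem {S : Matrix (Fin N × Fin d) (Fin N × Fin d) ℂ}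
    (hS : S.IsHermitian) : ∃ lam v, IsEigenSystem S lam v := by
  let e : Fin (N * d) ≃ Fin N × Fin d := finProdFinEquiv.symm
  exact ⟨fun s => hS.eigenvalues (e s), fun s => hS.eigenvectorBasis (e s),
    hS.eigenvectorBasis.orthonormal.comp e e.injective,
    fun s => hS.mulVec_eigenvectorBasis (e s)⟩

theorem span_eq_top_of_orthonormal {v : Fin (N * d) → EuclideanSpace ℂ (Fin N × Fin d)}
    (hv : Orthonormal ℂ v) : Submodule.span ℂ (Set.range v) = ⊤ :=
  hv.linearIndependent.span_eq_top_of_card_eq_finrank' (by simp)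

variable {ι : Type*} {d : ι → ℕ} {U : ∀ ℓ, K →ₜ* Matrix.unitaryGroup (Fin (d ℓ)) ℂ}

theorem hasEigenvector_eigenLp (hU : IsCompleteIrrepList U) (ε : ℝ) (x : Fin N → V) {ℓ : ι}
    {lam : Fin (N * d ℓ) → ℝ} {v : Fin (N * d ℓ) → EuclideanSpace ℂ (Fin N × Fin (d ℓ))}
    (h : IsEigenSystem (symbolMatrix ε x (U ℓ)) lam v) (s : Fin (N * d ℓ)) (m : Fin (d ℓ)) :
    Module.End.HasEigenvector (laplacian K ε x) (lam s : ℂ) (eigenLp (U ℓ) (v s) m) :=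
  ⟨Module.End.mem_eigenspace_iff.2 (laplacian_eigenLp_of_eigen ε x (U ℓ) (h.eigen s) m),
    eigenLp_ne_zero (U ℓ) (hU.irreducible ℓ) (h.orthonormal.ne_zero s) m⟩

theorem eigenvalue_nonneg [SecondCountableTopology K] (hU : IsCompleteIrrepList U) (ε : ℝ) (x : Fin N → V) {ℓ : ι}
    {lam : Fin (N * d ℓ) → ℝ} {v : Fin (N * d ℓ) → EuclideanSpace ℂ (Fin N × Fin (d ℓ))}
    (h : IsEigenSystem (symbolMatrix ε x (U ℓ)) lam v) (s : Fin (N * d ℓ)) : 0 ≤ lam s := by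
  -- The index `s` itself excludes d = 0, so a row m = 0 is available.
  have hd : 0 < d ℓ := Nat.pos_of_mul_pos_left s.pos
  have hv := hasEigenvector_eigenLp hU ε x h s ⟨0, hd⟩
  have hp := (isPositive_laplacian (K := K) ε x).2 (eigenLp (U ℓ) (v s) ⟨0, hd⟩)
  rw [hv.apply_eq_smul, inner_smul_left, Complex.conj_ofReal] at hp
  have hr : RCLike.re ((lam s : ℂ) * inner ℂ (eigenLp (U ℓ) (v s) ⟨0, hd⟩)
      (eigenLp (U ℓ) (v s) ⟨0, hd⟩)) = lam s * ‖eigenLp (U ℓ) (v s) ⟨0, hd⟩‖ ^ 2 := by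
    rw [inner_self_eq_norm_sq_to_K, RCLike.re_eq_complex_re, Complex.re_ofReal_mul]
    norm_cast
  rw [hr] at hp
  exact nonneg_of_mul_nonneg_left hp (by have := norm_pos_iff.2 hv.2; positivity)

end Symbol

/-! ### Completeness of the eigenfunctions and the spectrum of L -/

section Completeness

variable {K : Type*} [Group K] [TopologicalSpace K] [IsTopologicalGroup K] [CompactSpace K]
  [MeasurableSpace K] [BorelSpace K] [SecondCountableTopology K] [T2Space K]
  {N : ℕ} {ι : Type*} {d : ι → ℕ} {U : ∀ ℓ, K →ₜ* Matrix.unitaryGroup (Fin (d ℓ)) ℂ}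

theorem eq_zero_of_inner_eigenLp (hU : IsCompleteIrrepList U) {f : GammaL2 K N}
    (hf : ∀ ℓ (w : EuclideanSpace ℂ (Fin N × Fin (d ℓ))) m, inner ℂ (eigenLp (U ℓ) w m) f = 0) :
    f = 0 := by
  have hi : ∀ i, (f.memLp_slice i).toLp _ = 0 := by
    intro i
    rw [← Submodule.mem_bot ℂ, ← coeffSpan_orthogonal_eq_bot hU, mem_coeffSpan_orthogonal]
    intro ℓ m n
    -- For a standard basis vector, Φ_m is the coefficient U_mn on slice i and 0 on the others.
    have h := hf ℓ (EuclideanSpace.single (i, n) 1) m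
    unfold eigenLp at h
    rw [GammaL2.inner_toLp_eq_sum, Finset.sum_eq_single i] at h
    · rw [← h, L2.inner_def]
      refine integral_congr_ae ?_
      filter_upwards [ContinuousMap.coeFn_toLp (p := 2) (𝕜 := ℂ) (haarProb K) (coeff (U ℓ) m n),
        (f.memLp_slice i).coeFn_toLp] with κ hκ hκ'
      rw [hκ, hκ', RCLike.inner_apply]
      simp [eigenFun]
    · intro j _ hj
      simp [eigenFun, hj]
    · simp
  rw [← inner_self_eq_zero (𝕜 := ℂ), GammaL2.inner_eq_sum]
  refine Finset.sum_eq_zero fun i _ => ?_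
  have h0 := (MemLp.toLp_eq_toLp_iff (f.memLp_slice i) MemLp.zero).1 ((hi i).trans rfl)
  refine (integral_congr_ae (g := fun _ => 0) ?_).trans (integral_zero _ _)
  filter_upwards [h0] with κ hκ
  rw [hκ, Pi.zero_apply, zero_mul]

theorem eq_zero_of_inner_eigenSystem (hU : IsCompleteIrrepList U)
    {v : ∀ ℓ, Fin (N * d ℓ) → EuclideanSpace ℂ (Fin N × Fin (d ℓ))}
    (hv : ∀ ℓ, Orthonormal ℂ (v ℓ)) {f : GammaL2 K N}
    (hf : ∀ ℓ s m, inner ℂ (eigenLp (U ℓ) (v ℓ s) m) f = 0) : f = 0 := by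
  refine eq_zero_of_inner_eigenLp hU fun ℓ w m => ?_
  have hw : w ∈ Submodule.span ℂ (Set.range (v ℓ)) := by
    rw [span_eq_top_of_orthonormal (hv ℓ)]; trivial
  rw [← eigenLpLinear_apply]
  induction hw using Submodule.span_induction with
  | mem _ hx => obtain ⟨s, rfl⟩ := hx; exact hf ℓ s m
  | zero => rw [map_zero, inner_zero_left]
  | add _ _ _ _ h₁ h₂ => rw [map_add, inner_add_left, h₁, h₂, add_zero]
  | smul c _ _ h => rw [map_smul, inner_smul_left, h, mul_zero]

theorem topologicalClosure_span_eigenLp (hU : IsCompleteIrrepList U)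
    {v : ∀ ℓ, Fin (N * d ℓ) → EuclideanSpace ℂ (Fin N × Fin (d ℓ))}
    (hv : ∀ ℓ, Orthonormal ℂ (v ℓ)) :
    (Submodule.span ℂ (Set.range fun a : (ℓ : ι) × Fin (N * d ℓ) × Fin (d ℓ) =>
      eigenLp (U a.1) (v a.1 a.2.1) a.2.2)).topologicalClosure = ⊤ := by
  rw [Submodule.topologicalClosure_eq_top_iff, Submodule.eq_bot_iff]
  intro f hf
  exact eq_zero_of_inner_eigenSystem hU hv fun ℓ s m =>
    hf _ (Submodule.subset_span ⟨⟨ℓ, s, m⟩, rfl⟩)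

variable {V : Type*} [NormedAddCommGroup V] [MulAction K V] [IsIsometricSMul K V]
  [ContinuousSMul K V]

theorem hasEigenvalue_laplacian_iff (hU : IsCompleteIrrepList U) (ε : ℝ) (x : Fin N → V) (z : ℂ) :
    Module.End.HasEigenvalue (laplacian K ε x) z ↔
      ∃ ℓ, Module.End.HasEigenvalue (Matrix.toLin' (symbolMatrix ε x (U ℓ))) z := by
  constructor
  · intro hz
    obtain ⟨f, hf⟩ := hz.exists_hasEigenvector
    choose lam v hv using fun ℓ => exists_isEigenSystem (isHermitian_symbolMatrix ε x (U ℓ))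
    by_contra hno
    refine hf.2 (eq_zero_of_inner_eigenSystem hU (fun ℓ => (hv ℓ).orthonormal) fun ℓ s m => ?_)
    have hsymm := isSymmetric_laplacian (K := K) ε x (eigenLp (U ℓ) (v ℓ s) m) f
    rw [(hasEigenvector_eigenLp hU ε x (hv ℓ) s m).apply_eq_smul, hf.apply_eq_smul,
      inner_smul_left, inner_smul_right, Complex.conj_ofReal] at hsymm
    -- `hsymm` reads λ⟨Φ, f⟩ = z⟨Φ, f⟩; a nonzero pairing would make z = λ an eigenvalue of S_ℓ.
    by_contra hne
    refine hno ⟨ℓ, Module.End.hasEigenvalue_of_hasEigenvector (x := (v ℓ s).ofLp)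
      ⟨Module.End.mem_eigenspace_iff.2 ?_, fun h0 => (hv ℓ).orthonormal.ne_zero s ?_⟩⟩
    · rw [Matrix.toLin'_apply, (hv ℓ).eigen s, mul_right_cancel₀ hne hsymm]
    · exact WithLp.ofLp_injective 2 h0
  · rintro ⟨ℓ, hz⟩
    obtain ⟨w, hw⟩ := hz.exists_hasEigenvector
    have hw' : symbolMatrix ε x (U ℓ) *ᵥ w = z • w := by
      rw [← Matrix.toLin'_apply]; exact hw.apply_eq_smul
    -- A nonzero `w` has an index `p`, whose second component supplies a row m.
    obtain ⟨p, -⟩ := Function.ne_iff.1 hw.2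
    refine Module.End.hasEigenvalue_of_hasEigenvector (x := eigenLp (U ℓ) (WithLp.toLp 2 w) p.2)
      ⟨Module.End.mem_eigenspace_iff.2 (laplacian_eigenLp_of_eigen ε x (U ℓ) hw' p.2),
        eigenLp_ne_zero (U ℓ) (hU.irreducible ℓ) (fun h0 => hw.2 ?_) p.2⟩
    exact congrArg WithLp.ofLp h0

end Completeness

end InvariantGraphLaplacian

theorem mainTheorem1
    -- a compact Lie group
    {K : Type*} [Group K] [TopologicalSpace K] [IsTopologicalGroup K] [CompactSpace K] [T2Space K]
    [MeasurableSpace K] [BorelSpace K] {k : ℕ} [ChartedSpace (EuclideanSpace ℝ (Fin k)) K]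
    [LieGroup (𝓡 k) ∞ K]
    -- acting continuously, linearly and isometrically on a Euclidean space
    {q : ℕ} [DistribMulAction K (EuclideanSpace ℝ (Fin q))]
    [SMulCommClass K ℝ (EuclideanSpace ℝ (Fin q))]
    [IsIsometricSMul K (EuclideanSpace ℝ (Fin q))] [ContinuousSMul K (EuclideanSpace ℝ (Fin q))]
    -- the data points and the bandwidth of the kernel
    {N : ℕ} (x : Fin N → EuclideanSpace ℝ (Fin q)) (ε : ℝ) (hε : 0 < ε)
    -- the irreducible unitary matrix representations of `K`
    {ι : Type*} (d : ι → ℕ) (U : ∀ ℓ, K →ₜ* Matrix.unitaryGroup (Fin (d ℓ)) ℂ)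
    (hU : IsCompleteIrrepList U) :
    (laplacian K ε x).IsPositive ∧
    (∀ ℓ, (symbolMatrix ε x (U ℓ)).IsHermitian) ∧
    (∀ z : ℂ, Module.End.HasEigenvalue (laplacian K ε x) z ↔
      ∃ ℓ, Module.End.HasEigenvalue (Matrix.toLin' (symbolMatrix ε x (U ℓ))) z) ∧
    (∀ ℓ, ∃ lam v, IsEigenSystem (symbolMatrix ε x (U ℓ)) lam v) ∧
    ∀ (lam : ∀ ℓ, Fin (N * d ℓ) → ℝ)
      (v : ∀ ℓ, Fin (N * d ℓ) → EuclideanSpace ℂ (Fin N × Fin (d ℓ))),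
      (∀ ℓ, IsEigenSystem (symbolMatrix ε x (U ℓ)) (lam ℓ) (v ℓ)) →
      (∀ ℓ s, 0 ≤ lam ℓ s) ∧
      (∀ ℓ s m, Module.End.HasEigenvector (laplacian K ε x) (lam ℓ s : ℂ)
        (eigenLp (U ℓ) (v ℓ s) m)) ∧
      (Pairwise fun a b : (ℓ : ι) × Fin (N * d ℓ) × Fin (d ℓ) =>
        inner ℂ (eigenLp (U a.1) (v a.1 a.2.1) a.2.2) (eigenLp (U b.1) (v b.1 b.2.1) b.2.2) = 0) ∧
      (Submodule.span ℂ (Set.range fun a : (ℓ : ι) × Fin (N * d ℓ) × Fin (d ℓ) =>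
        eigenLp (U a.1) (v a.1 a.2.1) a.2.2)).topologicalClosure = ⊤ := by
  -- The manifold structure enters here: a compact space with Euclidean charts is second countable,
  -- as Fubini on K × K requires.
  have : SecondCountableTopology K :=
    ChartedSpace.secondCountable_of_sigmaCompact (EuclideanSpace ℝ (Fin k)) K
  have hS := fun ℓ => isHermitian_symbolMatrix ε x (U ℓ)
  refine ⟨isPositive_laplacian ε x, hS, hasEigenvalue_laplacian_iff hU ε x,
    fun ℓ => exists_isEigenSystem (hS ℓ), fun lam v h => ⟨?_, ?_, ?_, ?_⟩⟩
  · exact fun ℓ s => eigenvalue_nonneg hU ε x (h ℓ) s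
  · exact fun ℓ s m => hasEigenvector_eigenLp hU ε x (h ℓ) s m
  · exact pairwise_inner_eigenLp hU fun ℓ => (h ℓ).orthonormal
  · exact topologicalClosure_span_eigenLp hU fun ℓ => (h ℓ).orthonormal
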